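/- Let $M$ be a connected (Hausdorff, boundaryless) finite-dimensional smooth manifold, let $U\subset\mathbb R^m$ be any set, and let $F:M\times U\to TM$ be smooth with $F(x,u)\in T_xM$ for all $(x,u)\in M\times U$. Consider the control system $$\dot x=F(x,u(t)),\qquad x\in M,\ u(t)\in U. \tag{C}$$ Let $\mathcal U$ be one of the following classes of controls: (a) the piecewise constant controls $u:[0,T]\to U$, $T\ge 0$; (b) the controls in $\bigcup_{T\ge0}L^\infty([0,T],U)$, where in this case $F$ is assumed to be smooth on $M\times\overline U$ (which is no further assumption if $U$ is closed); (c) the measurable controls on intervals $[0,T]$, $T\ge0$, whose values lie, at almost every time, in a compact subset of $U$ (depending on the control). For $x\in M$, the attainable set $\mathcal A_x$ is the set of all points $\gamma(T)$, where $T\ge 0$, $u\in\mathcal U$ is a control on $[0,T]$, and $\gamma:[0,T]\to M$ is an absolutely continuous curve with $\gamma(0)=x$ and $\dot\gamma(t)=F(\gamma(t),u(t))$ for almost every $t\in[0,T]$. If (C) is locally controllable for the class $\mathcal U$, i.e. $x\in\operatorname{Int}\mathcal A_x$ for every $x\in M$, then it is controllable for the class $\mathcal U$, i.e. $\mathcal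 A_x=M$ for every $x\in M$. -/

import Mathlib

open Set MeasureTheory
open scoped Manifold ContDiff ENNReal

noncomputable section

namespace ControlSystem

/-- Smoothness on `M × V` of a controlled vector field `F : M × V → TM`, where `V ⊆ ℝᵐ` is an
arbitrary set. Values of `F` at controls outside `V` are irrelevant. -/
def SmoothOn {E : Type*} [NormedAddCommGroup E] [NormedSpace ℝ E]
    {M : Type*} [TopologicalSpace M] [ChartedSpace E M] [IsManifold 𝓘(ℝ, E) ∞ M] {m : ℕ}
    (F : (x : M) → EuclideanSpace ℝ (Fin m) → TangentSpace 𝓘(ℝ, E) x)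
    (V : Set (EuclideanSpace ℝ (Fin m))) : Prop :=
  ContMDiffOn (𝓘(ℝ, E).prod 𝓘(ℝ, EuclideanSpace ℝ (Fin m))) 𝓘(ℝ, E).tangent ∞
    (fun p : M × EuclideanSpace ℝ (Fin m) =>
      (⟨p.1, F p.1 p.2⟩ : TangentBundle 𝓘(ℝ, E) M))
    (univ ×ˢ V)

/-- Absolute continuity on `[0, T]` of a curve in a manifold: the curve is continuous, and its
expression in each chart is absolutely continuous on every compact interval that the curve maps
into the domain of the chart. -/
def AbsolutelyContinuousCurve (E : Type*) [NormedAddCommGroup E] [NormedSpace ℝ E]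
    {M : Type*} [TopologicalSpace M] [ChartedSpace E M] (T : ℝ) (γ : ℝ → M) : Prop :=
  ContinuousOn γ (Icc 0 T) ∧
    ∀ (x : M) (a b : ℝ), 0 ≤ a → a ≤ b → b ≤ T →
      MapsTo γ (Icc a b) (chartAt E x).source →
      AbsolutelyContinuousOnInterval (fun t => chartAt E x (γ t)) a b

/-- `γ` is, on `[0, T]`, an absolutely continuous solution of `γ' = F (γ, u)`, the equation being
satisfied at almost every time. -/
def IsTrajectory {E : Type*} [NormedAddCommGroup E] [NormedSpace ℝ E]
    {M : Type*} [TopologicalSpace M] [ChartedSpace E M] {m : ℕ}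
    (F : (x : M) → EuclideanSpace ℝ (Fin m) → TangentSpace 𝓘(ℝ, E) x)
    (T : ℝ) (u : ℝ → EuclideanSpace ℝ (Fin m)) (γ : ℝ → M) : Prop :=
  AbsolutelyContinuousCurve E T γ ∧
    ∀ᵐ t ∂(volume.restrict (Icc 0 T)),
      HasMFDerivAt 𝓘(ℝ, ℝ) 𝓘(ℝ, E) γ t ((1 : ℝ →L[ℝ] ℝ).smulRight (F (γ t) (u t)))

/-- Piecewise constant controls `[0, T] → U`: there is a finite partition
`0 = τ 0 ≤ τ 1 ≤ ⋯ ≤ τ n = T` such that `u` is constant on each open interval of it. -/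
def piecewiseConstantControls {m : ℕ} (U : Set (EuclideanSpace ℝ (Fin m))) (T : ℝ) :
    Set (ℝ → EuclideanSpace ℝ (Fin m)) :=
  {u | (∀ t ∈ Icc 0 T, u t ∈ U) ∧
    ∃ (n : ℕ) (τ : ℕ → ℝ), Monotone τ ∧ τ 0 = 0 ∧ τ n = T ∧
      ∀ i < n, ∃ v, ∀ t ∈ Ioo (τ i) (τ (i + 1)), u t = v}

/-- The controls in `L^∞([0, T], U)`: measurable, essentially bounded, with values in `U` at
almost every time. -/
def boundedControls {m : ℕ} (U : Set (EuclideanSpace ℝ (Fin m))) (T : ℝ) :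
    Set (ℝ → EuclideanSpace ℝ (Fin m)) :=
  {u | MemLp u ∞ (volume.restrict (Icc 0 T)) ∧ ∀ᵐ t ∂(volume.restrict (Icc 0 T)), u t ∈ U}

/-- The measurable controls on `[0, T]` with values, at almost every time, in some compact subset
of `U`. When `U` is closed these are exactly the controls in `L^∞([0, T], U)`. -/
def compactlyBoundedControls {m : ℕ} (U : Set (EuclideanSpace ℝ (Fin m))) (T : ℝ) :
    Set (ℝ → EuclideanSpace ℝ (Fin m)) :=
  {u | AEStronglyMeasurable u (volume.restrict (Icc 0 T)) ∧
    ∃ K : Set (EuclideanSpace ℝ (Fin m)), IsCompact K ∧ K ⊆ U ∧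
      ∀ᵐ t ∂(volume.restrict (Icc 0 T)), u t ∈ K}

/-- The attainable set from `x` for the class of controls `𝒰`, where `𝒰 T` is the set of
admissible controls on `[0, T]`. -/
def attainableSet {E : Type*} [NormedAddCommGroup E] [NormedSpace ℝ E]
    {M : Type*} [TopologicalSpace M] [ChartedSpace E M] {m : ℕ}
    (F : (x : M) → EuclideanSpace ℝ (Fin m) → TangentSpace 𝓘(ℝ, E) x)
    (𝒰 : ℝ → Set (ℝ → EuclideanSpace ℝ (Fin m))) (x : M) : Set M :=
  {y | ∃ T : ℝ, 0 ≤ T ∧ ∃ u ∈ 𝒰 T, ∃ γ : ℝ → M, IsTrajectory F T u γ ∧ γ 0 = x ∧ γ T = y}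

/-- Every point is interior to its attainable set. -/
def LocallyControllable {E : Type*} [NormedAddCommGroup E] [NormedSpace ℝ E]
    {M : Type*} [TopologicalSpace M] [ChartedSpace E M] {m : ℕ}
    (F : (x : M) → EuclideanSpace ℝ (Fin m) → TangentSpace 𝓘(ℝ, E) x)
    (𝒰 : ℝ → Set (ℝ → EuclideanSpace ℝ (Fin m))) : Prop :=
  ∀ x : M, x ∈ interior (attainableSet F 𝒰 x)

/-- Every attainable set is the whole state manifold. -/
def Controllable {E : Type*} [NormedAddCommGroup E] [NormedSpace ℝ E]
    {M : Type*} [TopologicalSpace M] [ChartedSpace E M] {m : ℕ}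
    (F : (x : M) → EuclideanSpace ℝ (Fin m) → TangentSpace 𝓘(ℝ, E) x)
    (𝒰 : ℝ → Set (ℝ → EuclideanSpace ℝ (Fin m))) : Prop :=
  ∀ x : M, attainableSet F 𝒰 x = univ

end ControlSystem

end

/-! Fix a target `y` and let `A` be the set of points from which `y` is attainable; any point that
can be steered into `A` lies in `A`. Let `discPoints E A k` be the set of points carrying an
immersed `C¹` disc of dimension `k` inside `A`, and take `k` maximal with this set, `D`, nonempty
(`k = 0` is always possible, because `y ∈ A`). The claim is that `D` is clopen, hence all of `M`,
hence `A = M`.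

`D` is backward invariant (`mem_discPoints_of_mem_attainableSet`): the backward flow along a fixed
control carries immersed discs to immersed discs, and it keeps them in `A`. So `D` is closed: if `z`
is in its closure, the neighbourhood of `z` attainable from `z` meets `D`, and backward invariance
puts `z` in `D`.

By maximality of `k`, every admissible field is tangent to the `k`-discs in `A`
(`chartField_mem_range`): otherwise, sliding a disc backward along a transverse field would sweep
out a disc of dimension `k + 1` in `A`. A trajectory starting on such a disc therefore stays on it
for a short time (`IsTrajectory.eventually_mem_discPoints`), by a Gronwall estimate for its distance
to the disc. Since `D` is closed, the whole trajectory stays in `D`; so `D` contains the attainable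
set of each of its points, which is a neighbourhood of that point, and `D` is open.

All this uses only the properties of the control class recorded in `IsAdmissibleClass`, which each
of the three classes satisfies. -/

namespace ControlSystem

open Filter Topology
open scoped NNReal

/-! ### Reparametrizing and gluing absolutely continuous curves. -/

section AbsolutelyContinuous

variable {X : Type*} [PseudoMetricSpace X]

/-- A monotone map sends disjoint half-open intervals to disjoint ones, and a nonexpansive map does
not increase their total length, so the same `δ` works. Applied to truncations and translations of
time. -/
theorem absolutelyContinuousOnInterval_comp {f : ℝ → X} {φ : ℝ → ℝ} {a b c d : ℝ}
    (hf : AbsolutelyContinuousOnInterval f c d) (hφ : Monotone φ)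
    (hφ' : ∀ x y, dist (φ x) (φ y) ≤ dist x y) (hmaps : MapsTo φ (uIcc a b) (uIcc c d)) :
    AbsolutelyContinuousOnInterval (f ∘ φ) a b := by
  rw [absolutelyContinuousOnInterval_iff] at hf ⊢
  intro ε hε
  obtain ⟨δ, hδ, H⟩ := hf ε hε
  refine ⟨δ, hδ, fun I hI hlt => ?_⟩
  refine H (I.1, fun i => (φ (I.2 i).1, φ (I.2 i).2)) ⟨fun i hi => ?_, ?_⟩ ?_
  · exact ⟨hmaps (hI.1 i hi).1, hmaps (hI.1 i hi).2⟩
  · intro i hi j hj hij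
    have key : ∀ p q z : ℝ, z ∈ uIoc (φ p) (φ q) →
        ∃ x ∈ uIoc p q, z ≤ φ x ∧ ∀ x' < min p q + 0, φ x' < z := by
      intro p q z hz
      rcases le_total p q with h | h
      · rw [uIoc_of_le (hφ h)] at hz
        have hpq : p < q := by
          rcases h.eq_or_lt with rfl | h
          · exact absurd (hz.1.trans_le hz.2) (lt_irrefl _)
          · exact h
        refine ⟨q, by rw [uIoc_of_le h]; exact ⟨hpq, le_rfl⟩, hz.2, fun x' hx' => ?_⟩
        rw [min_eq_left h, add_zero] at hx'
        exact (hφ hx'.le).trans_lt hz.1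
      · rw [uIoc_of_ge (hφ h)] at hz
        have hpq : q < p := by
          rcases h.eq_or_lt with rfl | h
          · exact absurd (hz.1.trans_le hz.2) (lt_irrefl _)
          · exact h
        refine ⟨p, by rw [uIoc_of_ge h]; exact ⟨hpq, le_rfl⟩, hz.2, fun x' hx' => ?_⟩
        rw [min_eq_right h, add_zero] at hx'
        exact (hφ hx'.le).trans_lt hz.1
    have hdisj := hI.2 hi hj hij
    rw [Function.onFun, Set.disjoint_left] at hdisj ⊢
    intro z hz hz'
    -- Disjoint nonempty half-open intervals are ordered on the line: otherwise the smaller right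
    -- endpoint would lie in both. Monotonicity preserves this order.
    have order : ∀ p q p' q' : ℝ, p < q → p' < q' →
        (∀ x, x ∈ Ioc p q → x ∉ Ioc p' q') → q ≤ p' ∨ q' ≤ p := by
      intro p q p' q' h h' hd
      by_contra! hc
      rcases le_total q q' with hq | hq
      · exact hd q ⟨h, le_rfl⟩ ⟨hc.1, hq⟩
      · exact hd q' ⟨hc.2, hq⟩ ⟨h', le_rfl⟩
    simp only [uIoc] at hz hz' hdisj
    have e1 : ∀ p q, min (φ p) (φ q) = φ (min p q) := fun p q => (hφ.map_min).symm
    have e2 : ∀ p q, max (φ p) (φ q) = φ (max p q) := fun p q => (hφ.map_max).symm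
    rw [e1, e2] at hz hz'
    have h1 : min (I.2 i).1 (I.2 i).2 < max (I.2 i).1 (I.2 i).2 := by
      by_contra! h
      exact absurd (hz.1.trans_le (hz.2.trans (hφ h))) (lt_irrefl _)
    have h2 : min (I.2 j).1 (I.2 j).2 < max (I.2 j).1 (I.2 j).2 := by
      by_contra! h
      exact absurd (hz'.1.trans_le (hz'.2.trans (hφ h))) (lt_irrefl _)
    rcases order _ _ _ _ h1 h2 (fun x hx hx' => hdisj hx hx') with h | h
    · exact absurd (hz'.1.trans_le (hz.2.trans (hφ h))) (lt_irrefl _)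
    · exact absurd (hz.1.trans_le (hz'.2.trans (hφ h))) (lt_irrefl _)
  · exact (Finset.sum_le_sum fun i _ => hφ' _ _).trans_lt hlt

theorem absolutelyContinuousOnInterval_congr {f g : ℝ → X} {a b : ℝ}
    (hf : AbsolutelyContinuousOnInterval f a b) (h : EqOn f g (uIcc a b)) :
    AbsolutelyContinuousOnInterval g a b := by
  rw [absolutelyContinuousOnInterval_iff] at hf ⊢
  intro ε hε
  obtain ⟨δ, hδ, H⟩ := hf ε hε
  refine ⟨δ, hδ, fun I hI hlt => ?_⟩
  convert H I hI hlt using 1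
  refine Finset.sum_congr rfl fun i hi => ?_
  rw [h (hI.1 i hi).1, h (hI.1 i hi).2]

/-- Uses the identity `f t = f (min t c) + f (max t c) - f c`, each term being absolutely continuous
on `[a, b]`. -/
theorem absolutelyContinuousOnInterval_trans {F : Type*} [NormedAddCommGroup F] {f : ℝ → F}
    {a b c : ℝ} (hac : a ≤ c) (hcb : c ≤ b)
    (h₁ : AbsolutelyContinuousOnInterval f a c) (h₂ : AbsolutelyContinuousOnInterval f c b) :
    AbsolutelyContinuousOnInterval f a b := by
  have hmin : AbsolutelyContinuousOnInterval (f ∘ fun t => min t c) a b := by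
    refine absolutelyContinuousOnInterval_comp h₁ (fun x y h => min_le_min_right c h)
      (fun x y => ?_) ?_
    · have := abs_min_sub_min_le_max x c y c
      simpa [Real.dist_eq] using this
    · intro t ht
      rw [uIcc_of_le (hac.trans hcb)] at ht
      rw [uIcc_of_le hac]
      exact ⟨le_min ht.1 hac, min_le_right _ _⟩
  have hmax : AbsolutelyContinuousOnInterval (f ∘ fun t => max t c) a b := by
    refine absolutelyContinuousOnInterval_comp h₂ (fun x y h => max_le_max_right c h)
      (fun x y => ?_) ?_
    · have := abs_max_sub_max_le_max x c y c
      simpa [Real.dist_eq] using this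
    · intro t ht
      rw [uIcc_of_le (hac.trans hcb)] at ht
      rw [uIcc_of_le hcb]
      exact ⟨le_max_right _ _, max_le ht.2 hcb⟩
  have hconst : AbsolutelyContinuousOnInterval (fun _ : ℝ => f c) a b :=
    LipschitzOnWith.absolutelyContinuousOnInterval (K := 0) (LipschitzWith.const _).lipschitzOnWith
  refine absolutelyContinuousOnInterval_congr ((hmin.add hmax).sub hconst) fun t _ => ?_
  rcases le_total t c with h | h <;> simp [h]

end AbsolutelyContinuous

/-! ### Curves with almost everywhere bounded derivative, and a Gronwall estimate. -/

section FundamentalTheorem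

variable {E : Type*} [NormedAddCommGroup E] [NormedSpace ℝ E] [FiniteDimensional ℝ E]
  {f f' : ℝ → E} {a b C : ℝ}

theorem intervalIntegrable_of_ae_hasDerivAt (hab : a ≤ b)
    (h : ∀ᵐ t ∂(volume.restrict (Icc a b)), HasDerivAt f (f' t) t)
    (hC : ∀ᵐ t ∂(volume.restrict (Icc a b)), ‖f' t‖ ≤ C) :
    IntervalIntegrable f' volume a b := by
  have := FiniteDimensional.complete ℝ E
  rw [intervalIntegrable_iff_integrableOn_Icc_of_le hab]
  have hm : AEStronglyMeasurable f' (volume.restrict (Icc a b)) := by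
    refine ((stronglyMeasurable_deriv f).aestronglyMeasurable).congr ?_
    filter_upwards [h] with t ht using ht.deriv
  exact Integrable.of_bound hm C hC

omit [FiniteDimensional ℝ E] in
theorem norm_integral_le_of_ae_norm_le {w : ℝ → E}
    (hC : ∀ᵐ t ∂(volume.restrict (Icc a b)), ‖w t‖ ≤ C) {s t : ℝ} (hs : s ∈ Icc a b)
    (ht : t ∈ Icc a b) : ‖∫ r in s..t, w r‖ ≤ C * |t - s| := by
  refine intervalIntegral.norm_integral_le_of_norm_le_const_ae ?_
  rw [ae_restrict_iff' measurableSet_Icc] at hC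
  filter_upwards [hC] with r hr hrr
  refine hr ?_
  have := uIoc_subset_uIcc hrr
  exact (uIcc_subset_Icc hs ht) this

/-- The primitive of `f'` is Lipschitz, so `f` minus it is absolutely continuous with derivative
zero almost everywhere, hence constant. -/
theorem eq_add_integral_of_ae_hasDerivAt (hab : a ≤ b)
    (hf : AbsolutelyContinuousOnInterval f a b)
    (h : ∀ᵐ t ∂(volume.restrict (Icc a b)), HasDerivAt f (f' t) t)
    (hC : ∀ᵐ t ∂(volume.restrict (Icc a b)), ‖f' t‖ ≤ C) {s t : ℝ} (hs : s ∈ Icc a b)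
    (ht : t ∈ Icc a b) : f t = f s + ∫ r in s..t, f' r := by
  have := FiniteDimensional.complete ℝ E
  have hint := intervalIntegrable_of_ae_hasDerivAt hab h hC
  have hsub : ∀ p ∈ Icc a b, ∀ q ∈ Icc a b, IntervalIntegrable f' volume p q := fun p hp q hq =>
    hint.mono_set (by rw [uIcc_of_le hab]; exact uIcc_subset_Icc hp hq)
  have ha : a ∈ Icc a b := ⟨le_rfl, hab⟩
  have hlip : LipschitzOnWith (Real.toNNReal C) (fun x => ∫ r in a..x, f' r) (uIcc a b) := by
    rw [uIcc_of_le hab]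
    refine LipschitzOnWith.of_dist_le_mul fun x hx y hy => ?_
    rw [dist_eq_norm, intervalIntegral.integral_interval_sub_left (hsub a ha x hx) (hsub a ha y hy)]
    refine (norm_integral_le_of_ae_norm_le hC hy hx).trans ?_
    rw [Real.dist_eq]
    gcongr
    exact Real.le_coe_toNNReal C
  have hac := hf.sub hlip.absolutelyContinuousOnInterval
  obtain ⟨c, hc⟩ := hac.const_of_ae_hasDerivAt_zero (by
    rw [ae_restrict_iff' measurableSet_Icc] at h
    filter_upwards [h, hint.ae_hasDerivAt_integral] with x hx hx' hxm
    rw [uIcc_of_le hab] at hxm hx'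
    have := (hx hxm).sub (hx' hxm a ha)
    rwa [sub_self] at this)
  rw [uIcc_of_le hab] at hc
  have h1 := hc s hs
  have h2 := hc t ht
  simp only [Pi.sub_apply] at h1 h2
  rw [← intervalIntegral.integral_interval_sub_left (hsub a ha t ht) (hsub a ha s hs)]
  have h3 : f t = c + ∫ r in a..t, f' r := by rw [← h2]; abel
  have h4 : f s = c + ∫ r in a..s, f' r := by rw [← h1]; abel
  rw [h3, h4]; abel

theorem lipschitzOnWith_of_ae_hasDerivAt (hab : a ≤ b)
    (hf : AbsolutelyContinuousOnInterval f a b)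
    (h : ∀ᵐ t ∂(volume.restrict (Icc a b)), HasDerivAt f (f' t) t)
    (hC : ∀ᵐ t ∂(volume.restrict (Icc a b)), ‖f' t‖ ≤ C) :
    LipschitzOnWith (Real.toNNReal C) f (Icc a b) := by
  refine LipschitzOnWith.of_dist_le_mul fun x hx y hy => ?_
  rw [dist_eq_norm, eq_add_integral_of_ae_hasDerivAt hab hf h hC hy hx, add_sub_cancel_left]
  refine (norm_integral_le_of_ae_norm_le hC hy hx).trans ?_
  rw [Real.dist_eq]
  gcongr
  exact Real.le_coe_toNNReal C

/-- Gronwall on a short interval: at a maximum `t₀` of `‖f‖`, integrating from `a` gives `‖f t₀‖ ≤ C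
(b - a) ‖f t₀‖ ≤ ‖f t₀‖ / 2`. -/
theorem eqOn_zero_of_ae_norm_deriv_le (hab : a ≤ b) (hCab : C * (b - a) ≤ 1 / 2) (hC0 : 0 ≤ C)
    (hf : AbsolutelyContinuousOnInterval f a b)
    (h : ∀ᵐ t ∂(volume.restrict (Icc a b)), HasDerivAt f (f' t) t)
    (hC : ∀ᵐ t ∂(volume.restrict (Icc a b)), ‖f' t‖ ≤ C * ‖f t‖) (ha : f a = 0) :
    ∀ t ∈ Icc a b, f t = 0 := by
  have hcont : ContinuousOn f (Icc a b) := by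
    have := hf.continuousOn
    rwa [uIcc_of_le hab] at this
  obtain ⟨t₀, ht₀, hmax⟩ := isCompact_Icc.exists_isMaxOn ⟨a, le_rfl, hab⟩ hcont.norm
  have hbd : ∀ᵐ t ∂(volume.restrict (Icc a b)), ‖f' t‖ ≤ C * ‖f t₀‖ := by
    filter_upwards [hC, ae_restrict_mem measurableSet_Icc] with t ht htm
    exact ht.trans (mul_le_mul_of_nonneg_left (hmax htm) hC0)
  have hle : ‖f t₀‖ ≤ C * ‖f t₀‖ * |t₀ - a| := by
    have := eq_add_integral_of_ae_hasDerivAt hab hf h hbd ⟨le_rfl, hab⟩ ht₀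
    rw [ha, zero_add] at this
    nth_rw 1 [this]
    exact norm_integral_le_of_ae_norm_le hbd
      ⟨le_rfl, hab⟩ ht₀
  have h0 : ‖f t₀‖ ≤ 1 / 2 * ‖f t₀‖ := by
    rw [abs_of_nonneg (by linarith [ht₀.1])] at hle
    calc ‖f t₀‖ ≤ C * ‖f t₀‖ * (t₀ - a) := hle
      _ ≤ C * ‖f t₀‖ * (b - a) := by gcongr; exact ht₀.2
      _ = C * (b - a) * ‖f t₀‖ := by ring
      _ ≤ _ := by gcongr
  intro t ht
  have := hmax ht
  simp only [mem_ofPred_eq] at this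
  exact norm_le_zero_iff.mp (by linarith [norm_nonneg (f t₀)])

end FundamentalTheorem

/-! ### Picard operator and backward flow for measurable controls. -/

section LipschitzFamily

/-- A continuous family, indexed by a compact space `K`, of `C¹` vector fields with uniformly
bounded derivatives. -/
structure IsLipschitzFamily {E K : Type*} [NormedAddCommGroup E] [NormedSpace ℝ E]
    [TopologicalSpace K] (g : E → K → E) (g' : E → K → E →L[ℝ] E) (L : ℝ) : Prop where
  continuous : Continuous fun p : E × K => g p.1 p.2
  continuous' : Continuous fun p : E × K => g' p.1 p.2
  hasFDerivAt : ∀ x k, HasFDerivAt (fun y => g y k) (g' x k) x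
  norm_le : ∀ x k, ‖g' x k‖ ≤ L

section PicardOperator

variable {E K : Type*} [NormedAddCommGroup E] [NormedSpace ℝ E] [TopologicalSpace K]
  [CompactSpace K] {g : E → K → E} {g' : E → K → E →L[ℝ] E} {L : ℝ}

omit [CompactSpace K] in
theorem IsLipschitzFamily.norm_sub_le (hg : IsLipschitzFamily g g' L) (x y : E) (k : K) :
    ‖g y k - g x k‖ ≤ L * ‖y - x‖ :=
  Convex.norm_image_sub_le_of_norm_hasFDerivWithin_le
    (fun z _ => (hg.hasFDerivAt z k).hasFDerivWithinAt) (fun z _ => hg.norm_le z k) convex_univ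
    (mem_univ x) (mem_univ y)

variable {a b : ℝ} {u : ℝ → K}

omit [NormedSpace ℝ E] in
theorem intervalIntegrable_of_continuous_curve {F : Type*} [NormedAddCommGroup F]
    {G : E → K → F} (hG : Continuous fun p : E × K => G p.1 p.2) (hu : StronglyMeasurable u)
    {c : ℝ → E} (hc : Continuous c) (s t : ℝ) :
    IntervalIntegrable (fun r => G (c r) (u r)) volume s t := by
  have hm : AEStronglyMeasurable (fun r => G (c r) (u r)) (volume.restrict (uIoc s t)) :=
    (hG.comp_stronglyMeasurable (hc.stronglyMeasurable.prodMk hu)).aestronglyMeasurable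
  obtain ⟨C, hC⟩ := ((isCompact_uIcc (a := s) (b := t)).image hc |>.prod
    (isCompact_univ (X := K))).exists_bound_of_continuousOn hG.continuousOn
  rw [intervalIntegrable_iff]
  have : IsFiniteMeasure (volume.restrict (uIoc s t)) := ⟨by simp [uIoc]⟩
  refine Integrable.of_bound hm C ?_
  filter_upwards [ae_restrict_mem measurableSet_uIoc] with r hr
  exact hC (c r, u r) ⟨mem_image_of_mem _ (uIoc_subset_uIcc hr), mem_univ _⟩

/-- The Picard operator `γ ↦ ∫ s in b..·, g (γ s) (u s)` on continuous curves. -/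
noncomputable def picard (hab : a ≤ b) (hg : IsLipschitzFamily g g' L) (hu : StronglyMeasurable u)
    (γ : C(Icc a b, E)) : C(Icc a b, E) where
  toFun t := ∫ s in b..t, g (IccExtend hab γ s) (u s)
  continuous_toFun := (intervalIntegral.continuous_primitive
    (intervalIntegrable_of_continuous_curve hg.continuous hu
      γ.continuous.Icc_extend') b).comp continuous_subtype_val

omit [CompactSpace K] in
theorem continuous_linearized (hg : IsLipschitzFamily g g' L) :
    Continuous fun p : (E × E) × K => g' p.1.1 p.2 p.1.2 := by
  have := hg.continuous'.comp (continuous_fst.fst.prodMk continuous_snd :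
    Continuous fun p : (E × E) × K => (p.1.1, p.2))
  exact this.clm_apply continuous_fst.snd

theorem intervalIntegrable_linearized (hg : IsLipschitzFamily g g' L) (hu : StronglyMeasurable u)
    {c d : ℝ → E} (hc : Continuous c) (hd : Continuous d) (s t : ℝ) :
    IntervalIntegrable (fun r => g' (c r) (u r) (d r)) volume s t :=
  intervalIntegrable_of_continuous_curve (G := fun (p : E × E) k => g' p.1 k p.2)
    (continuous_linearized hg) hu (hc.prodMk hd) s t

theorem norm_integral_le_mul {w : ℝ → E} {C : ℝ} (hC0 : 0 ≤ C) (t : Icc a b)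
    (h : ∀ s ∈ Icc a b, ‖w s‖ ≤ C) : ‖∫ s in b..t, w s‖ ≤ C * (b - a) := by
  refine (intervalIntegral.norm_integral_le_of_norm_le_const fun s hs => h s ?_).trans ?_
  · rw [uIoc_of_ge t.2.2] at hs
    exact ⟨t.2.1.trans hs.1.le, hs.2⟩
  · gcongr
    rw [abs_of_nonpos (by linarith [t.2.2])]
    linarith [t.2.1]

/-- The derivative of the Picard operator. -/
noncomputable def picardDeriv (hab : a ≤ b) (hg : IsLipschitzFamily g g' L)
    (hu : StronglyMeasurable u) (hL : 0 ≤ L) (γ : C(Icc a b, E)) :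
    C(Icc a b, E) →L[ℝ] C(Icc a b, E) :=
  LinearMap.mkContinuous
    { toFun := fun η =>
        { toFun := fun t => ∫ s in b..t, g' (IccExtend hab γ s) (u s) (IccExtend hab η s)
          continuous_toFun := (intervalIntegral.continuous_primitive
            (intervalIntegrable_linearized hg hu
              γ.continuous.Icc_extend' η.continuous.Icc_extend') b).comp
              continuous_subtype_val }
      map_add' := fun η₁ η₂ => by
        ext t
        have := fun η : C(Icc a b, E) =>
          (intervalIntegrable_linearized hg hu
              (γ.continuous.Icc_extend' (h := hab)) (η.continuous.Icc_extend' (h := hab)))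
        simp only [ContinuousMap.coe_mk, ContinuousMap.add_apply]
        rw [← intervalIntegral.integral_add (this η₁ b t) (this η₂ b t)]
        simp [IccExtend]
      map_smul' := fun c η => by
        ext t
        simp only [ContinuousMap.coe_mk, ContinuousMap.smul_apply, RingHom.id_apply]
        rw [← intervalIntegral.integral_smul]
        simp [IccExtend] }
    (L * (b - a)) fun η => by
      rw [ContinuousMap.norm_le _ (by have := sub_nonneg.2 hab; positivity)]
      intro t
      simp only [LinearMap.coe_mk, AddHom.coe_mk, ContinuousMap.coe_mk]
      refine (norm_integral_le_mul (C := L * ‖η‖) (by positivity) t fun s _ => ?_).trans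
        (by apply le_of_eq; ring)
      refine (ContinuousLinearMap.le_opNorm _ _).trans ?_
      gcongr
      · exact hg.norm_le _ _
      · exact η.norm_coe_le_norm _

theorem picardDeriv_apply (hab : a ≤ b) (hg : IsLipschitzFamily g g' L)
    (hu : StronglyMeasurable u) (hL : 0 ≤ L) (γ η : C(Icc a b, E)) (t : Icc a b) :
    picardDeriv hab hg hu hL γ η t
      = ∫ s in b..t, g' (IccExtend hab γ s) (u s) (IccExtend hab η s) := rfl

theorem norm_picardDeriv_le (hab : a ≤ b) (hg : IsLipschitzFamily g g' L)
    (hu : StronglyMeasurable u) (hL : 0 ≤ L) (γ : C(Icc a b, E)) :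
    ‖picardDeriv hab hg hu hL γ‖ ≤ L * (b - a) :=
  LinearMap.mkContinuous_norm_le _ (by have := sub_nonneg.2 hab; positivity) _

/-- Since `[a, b] × K` is compact, the tube lemma at displacement `0` makes the continuity of `g'`
along `γ` uniform in time and control. This is the modulus behind both the differentiability and the
`C¹` regularity of the Picard operator. -/
theorem exists_forall_norm_deriv_sub_lt (hg : IsLipschitzFamily g g' L) (γ : C(Icc a b, E))
    {ε : ℝ} (hε : 0 < ε) :
    ∃ δ > 0, ∀ (s : Icc a b) (k : K) (y : E), ‖y - γ s‖ < δ → ‖g' y k - g' (γ s) k‖ < ε := by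
  have h1 : Continuous fun q : E × (Icc a b × K) =>
      g' (γ q.2.1 + q.1) q.2.2 - g' (γ q.2.1) q.2.2 := by
    refine Continuous.sub ?_ ?_
    · exact hg.continuous'.comp (((γ.continuous.comp continuous_snd.fst).add continuous_fst).prodMk
        continuous_snd.snd)
    · exact hg.continuous'.comp ((γ.continuous.comp continuous_snd.fst).prodMk continuous_snd.snd)
  have h2 := (isCompact_univ (X := Icc a b × K)).eventually_forall_of_forall_eventually
    (x₀ := (0 : E)) (P := fun h p => ‖g' (γ p.1 + h) p.2 - g' (γ p.1) p.2‖ < ε) (by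
      intro p _
      have : ∀ᶠ q in 𝓝 ((0 : E), p), ‖g' (γ q.2.1 + q.1) q.2.2 - g' (γ q.2.1) q.2.2‖ < ε :=
        h1.norm.continuousAt.eventually (gt_mem_nhds (by simpa using hε))
      exact this)
  obtain ⟨δ, hδ, H⟩ := Metric.eventually_nhds_iff.mp h2
  refine ⟨δ, hδ, fun s k y hy => ?_⟩
  have := H (y := y - γ s) (by simpa [dist_eq_norm] using hy) (s, k) (mem_univ _)
  simpa using this

theorem hasFDerivAt_picard (hab : a ≤ b) (hg : IsLipschitzFamily g g' L)
    (hu : StronglyMeasurable u) (hL : 0 ≤ L) (γ : C(Icc a b, E)) :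
    HasFDerivAt (picard hab hg hu) (picardDeriv hab hg hu hL γ) γ := by
  rw [hasFDerivAt_iff_isLittleO, Asymptotics.isLittleO_iff]
  intro c hc
  have hba : 0 ≤ b - a := sub_nonneg.2 hab
  -- The `+ 1` keeps the denominator positive when `a = b`.
  obtain ⟨δ, hδ, H⟩ := exists_forall_norm_deriv_sub_lt hg γ
    (ε := c / (b - a + 1)) (by positivity)
  filter_upwards [Metric.ball_mem_nhds γ hδ] with η hη
  rw [Metric.mem_ball, dist_eq_norm] at hη
  rw [ContinuousMap.norm_le _ (by positivity)]
  intro t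
  simp only [ContinuousMap.sub_apply, picardDeriv_apply]
  have hI := fun η : C(Icc a b, E) => (intervalIntegrable_of_continuous_curve hg.continuous hu
      (η.continuous.Icc_extend' (h := hab)))
  have hI' := (intervalIntegrable_linearized hg hu
    (γ.continuous.Icc_extend' (h := hab)) ((η - γ).continuous.Icc_extend' (h := hab)))
  change ‖(∫ s in b..t, _) - (∫ s in b..t, _) - ∫ s in b..t, _‖ ≤ _
  rw [← intervalIntegral.integral_sub (hI η b t) (hI γ b t),
    ← intervalIntegral.integral_sub ((hI η b t).sub (hI γ b t)) (hI' b t)]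
  refine (norm_integral_le_mul (C := c / (b - a + 1) * ‖η - γ‖) (by positivity) t
    fun s _ => ?_).trans ?_
  · have hs : ‖IccExtend hab η s - IccExtend hab γ s‖ ≤ ‖η - γ‖ :=
      (η - γ).norm_coe_le_norm (projIcc a b hab s)
    refine (Convex.norm_image_sub_le_of_norm_hasFDerivWithin_le' (f := fun y => g y (u s))
      (f' := fun y => g' y (u s)) (s := Metric.ball (IccExtend hab γ s) δ)
      (φ := g' (IccExtend hab γ s) (u s)) (C := c / (b - a + 1))
      (fun z _ => (hg.hasFDerivAt z _).hasFDerivWithinAt)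
      (fun z hz => (H (projIcc a b hab s) (u s) z (by
        rw [Metric.mem_ball, dist_eq_norm] at hz; exact hz)).le)
      (convex_ball _ _) (Metric.mem_ball_self hδ)
      (by rw [Metric.mem_ball, dist_eq_norm]; exact hs.trans_lt hη)).trans ?_
    gcongr
  · have : c / (b - a + 1) * (b - a) ≤ c := by
      rw [div_mul_eq_mul_div, div_le_iff₀ (by positivity)]
      nlinarith
    calc c / (b - a + 1) * ‖η - γ‖ * (b - a) = c / (b - a + 1) * (b - a) * ‖η - γ‖ := by ring
      _ ≤ _ := by gcongr

theorem continuous_picardDeriv (hab : a ≤ b) (hg : IsLipschitzFamily g g' L)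
    (hu : StronglyMeasurable u) (hL : 0 ≤ L) : Continuous (picardDeriv hab hg hu hL) := by
  refine (Metric.continuous_iff (α := C(Icc a b, E))
    (β := C(Icc a b, E) →L[ℝ] C(Icc a b, E))).2 fun γ ε hε => ?_
  have hba : 0 ≤ b - a := sub_nonneg.2 hab
  obtain ⟨δ, hδ, H⟩ := exists_forall_norm_deriv_sub_lt hg γ
    (ε := ε / (2 * (b - a + 1))) (by positivity)
  refine ⟨δ, hδ, fun η hη => ?_⟩
  rw [dist_eq_norm] at hη
  refine (dist_eq_norm (picardDeriv hab hg hu hL η) (picardDeriv hab hg hu hL γ)).trans_lt ?_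
  have hlt : ε / (2 * (b - a + 1)) * (b - a) < ε := by
    rw [div_mul_eq_mul_div, div_lt_iff₀ (by positivity)]
    nlinarith
  refine lt_of_le_of_lt (ContinuousLinearMap.opNorm_le_bound _ (by positivity) fun ξ => ?_) hlt
  rw [ContinuousMap.norm_le _ (by positivity)]
  intro t
  have hI := fun η : C(Icc a b, E) =>
    (intervalIntegrable_linearized hg hu
    (η.continuous.Icc_extend' (h := hab)) (ξ.continuous.Icc_extend' (h := hab)))
  simp only [sub_apply, ContinuousMap.sub_apply, picardDeriv_apply]
  rw [← intervalIntegral.integral_sub (hI η b t) (hI γ b t)]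
  refine (norm_integral_le_mul (C := ε / (2 * (b - a + 1)) * ‖ξ‖) (by positivity) t
    fun s _ => ?_).trans (le_of_eq (by ring))
  rw [← sub_apply]
  refine (ContinuousLinearMap.le_opNorm _ _).trans ?_
  gcongr
  · exact (H (projIcc a b hab s) (u s) _
      (((η - γ).norm_coe_le_norm (projIcc a b hab s)).trans_lt hη)).le
  · exact ξ.norm_coe_le_norm _

theorem norm_picard_sub_le (hab : a ≤ b) (hg : IsLipschitzFamily g g' L)
    (hu : StronglyMeasurable u) (hL : 0 ≤ L) (γ η : C(Icc a b, E)) :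
    ‖picard hab hg hu γ - picard hab hg hu η‖ ≤ L * (b - a) * ‖γ - η‖ := by
  have hba : 0 ≤ b - a := sub_nonneg.2 hab
  rw [ContinuousMap.norm_le _ (by positivity)]
  intro t
  have hI := fun η : C(Icc a b, E) => (intervalIntegrable_of_continuous_curve hg.continuous hu
      (η.continuous.Icc_extend' (h := hab)))
  rw [ContinuousMap.sub_apply]
  change ‖(∫ s in b..t, _) - (∫ s in b..t, _)‖ ≤ _
  rw [← intervalIntegral.integral_sub (hI γ b t) (hI η b t)]
  refine (norm_integral_le_mul (C := L * ‖γ - η‖) (by positivity) t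
    fun s _ => ?_).trans (le_of_eq (by ring))
  refine (hg.norm_sub_le _ _ _).trans ?_
  gcongr
  exact (γ - η).norm_coe_le_norm (projIcc a b hab s)

end PicardOperator

section Flow

variable {E K : Type*} [NormedAddCommGroup E] [NormedSpace ℝ E] [CompleteSpace E]
  [TopologicalSpace K] [CompactSpace K] {g : E → K → E} {g' : E → K → E →L[ℝ] E} {L : ℝ}
  {a b : ℝ} {u : ℝ → K}

/-- On a short interval `[a, b]`, the map sending a curve `γ` to the defect of the integral
equation with final time `b` is a homeomorphism with `C¹` inverse. -/
theorem exists_homeomorph_sub_picard (hab : a ≤ b) (hg : IsLipschitzFamily g g' L)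
    (hu : StronglyMeasurable u) (hL : 0 ≤ L) (hlt : L * (b - a) ≤ 1 / 4) :
    ∃ Q : C(Icc a b, E) ≃ₜ C(Icc a b, E), (∀ γ, Q γ = γ - picard hab hg hu γ) ∧
      ContDiff ℝ 1 Q.symm := by
  -- The Picard operator is `1/4`-Lipschitz, so `1 - picard` is a Lipschitz perturbation of the
  -- identity and a global homeomorphism.
  have happ : ApproximatesLinearOn (fun γ => γ - picard hab hg hu γ)
      ((ContinuousLinearEquiv.refl ℝ C(Icc a b, E) : C(Icc a b, E) ≃L[ℝ] C(Icc a b, E)) :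
        C(Icc a b, E) →L[ℝ] C(Icc a b, E)) univ (1 / 4 : ℝ≥0) := by
    intro γ _ η _
    have : γ - picard hab hg hu γ - (η - picard hab hg hu η)
        - (ContinuousLinearEquiv.refl ℝ C(Icc a b, E) : C(Icc a b, E) →L[ℝ] C(Icc a b, E)) (γ - η)
        = -(picard hab hg hu γ - picard hab hg hu η) := by
      simp; abel
    rw [this, norm_neg]
    refine (norm_picard_sub_le hab hg hu hL γ η).trans ?_
    gcongr
    simpa using hlt
  have hsub : Subsingleton C(Icc a b, E) ∨ (1 / 4 : ℝ≥0) <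
      ‖((ContinuousLinearEquiv.refl ℝ C(Icc a b, E)).symm :
        C(Icc a b, E) →L[ℝ] C(Icc a b, E))‖₊⁻¹ := by
    rcases subsingleton_or_nontrivial C(Icc a b, E) with h | h
    · exact Or.inl h
    · right
      have : ‖((ContinuousLinearEquiv.refl ℝ C(Icc a b, E)).symm :
        C(Icc a b, E) →L[ℝ] C(Icc a b, E))‖₊ = 1 := ContinuousLinearMap.nnnorm_id
      rw [this, inv_one]
      rw [← NNReal.coe_lt_coe]; norm_num
  let Q := happ.toHomeomorph _ hsub
  have hQ : ∀ γ, Q γ = γ - picard hab hg hu γ := fun γ => rfl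
  have hnorm : ∀ γ, ‖picardDeriv hab hg hu hL γ‖ < 1 := fun γ =>
    (norm_picardDeriv_le hab hg hu hL γ).trans_lt (hlt.trans_lt (by norm_num))
  -- The derivative `1 - picardDeriv` is invertible by the Neumann series.
  let D : C(Icc a b, E) → C(Icc a b, E) ≃L[ℝ] C(Icc a b, E) := fun γ =>
    ContinuousLinearEquiv.ofUnit (Units.oneSub (picardDeriv hab hg hu hL γ) (hnorm γ) :
      (C(Icc a b, E) →L[ℝ] C(Icc a b, E))ˣ)
  have hD : ∀ γ, HasFDerivAt Q ((D γ : C(Icc a b, E) →L[ℝ] C(Icc a b, E))) γ := by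
    intro γ
    have h := (hasFDerivAt_id γ).sub (hasFDerivAt_picard hab hg hu hL γ)
    exact h
  refine ⟨Q, hQ, Q.contDiff_symm hD ?_⟩
  rw [contDiff_one_iff_hasFDerivAt]
  refine ⟨fun γ => (D γ : C(Icc a b, E) →L[ℝ] C(Icc a b, E)), ?_, hD⟩
  exact continuous_const.sub (continuous_picardDeriv hab hg hu hL)

/-- Backward flow of a time-dependent vector field `g · (u t)`, `u` being a measurable control:
`Γ x` is the solution on `[a, b]` with final value `x`. -/
theorem exists_backward_flow (hab : a ≤ b) (hg : IsLipschitzFamily g g' L)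
    (hu : StronglyMeasurable u) (hL : 0 ≤ L) (hlt : L * (b - a) ≤ 1 / 4) :
    ∃ Γ : E → ℝ → E, (∀ x, Continuous (Γ x)) ∧
      (∀ x, ∀ t ∈ Icc a b, Γ x t = x + ∫ s in b..t, g (Γ x s) (u s)) ∧
      ContDiff ℝ 1 (fun x => Γ x a) ∧
      (∀ x, Function.Injective (fderiv ℝ (fun x => Γ x a) x)) ∧
      (∀ x y, ∀ t ∈ Icc a b, ‖Γ y t - Γ x t‖ ≤ 2 * ‖y - x‖) ∧
      (∀ c : ℝ → E, ContinuousOn c (Icc a b) →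
        (∀ t ∈ Icc a b, c t = c b + ∫ s in b..t, g (c s) (u s)) →
        EqOn c (Γ (c b)) (Icc a b)) := by
  obtain ⟨Q, hQ, hQs⟩ := exists_homeomorph_sub_picard hab hg hu hL hlt
  -- Solving `Q γ = const x` is the integral equation with final value `x`. Regularity in `x` is
  -- inherited from `Q.symm`, the embedding of constants and evaluation being continuous linear.
  let γ : E → C(Icc a b, E) := fun x => Q.symm (ContinuousMap.const _ x)
  have hγ : ∀ x, γ x = ContinuousMap.const _ x + picard hab hg hu (γ x) := by
    intro x
    have := hQ (γ x)
    rw [Q.apply_symm_apply] at this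
    rw [this]; abel
  have hlip : ∀ x y, ‖γ y - γ x‖ ≤ 2 * ‖y - x‖ := by
    intro x y
    have h1 : γ y - γ x = ContinuousMap.const _ (y - x)
        + (picard hab hg hu (γ y) - picard hab hg hu (γ x)) := by
      nth_rw 1 [hγ x, hγ y]
      ext t; simp; abel
    have h2 : ‖γ y - γ x‖ ≤ ‖y - x‖ + L * (b - a) * ‖γ y - γ x‖ := by
      nth_rw 1 [h1]
      refine (norm_add_le _ _).trans (add_le_add ?_ (norm_picard_sub_le hab hg hu hL _ _))
      exact (ContinuousMap.norm_le _ (norm_nonneg _)).2 fun t => le_rfl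
    have h3 : L * (b - a) * ‖γ y - γ x‖ ≤ 1 / 4 * ‖γ y - γ x‖ := by gcongr
    linarith [norm_nonneg (γ y - γ x)]
  have ha : a ∈ Icc a b := ⟨le_rfl, hab⟩
  have hext : ∀ x, ∀ t (ht : t ∈ Icc a b), IccExtend hab (γ x) t = γ x ⟨t, ht⟩ := fun x t ht =>
    IccExtend_of_mem hab _ ht
  have hsol : ∀ x, ∀ t ∈ Icc a b, IccExtend hab (γ x) t
      = x + ∫ s in b..t, g (IccExtend hab (γ x) s) (u s) := by
    intro x t ht
    rw [hext x t ht]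
    nth_rw 1 [hγ x]
    rfl
  have hlip' : ∀ x y, ∀ t ∈ Icc a b,
      ‖IccExtend hab (γ y) t - IccExtend hab (γ x) t‖ ≤ 2 * ‖y - x‖ := by
    intro x y t ht
    rw [hext x t ht, hext y t ht, ← ContinuousMap.sub_apply]
    exact ((γ y - γ x).norm_coe_le_norm _).trans (hlip x y)
  have hdiff : ContDiff ℝ 1 (fun x => IccExtend hab (γ x) a) := by
    have hconst : ContDiff ℝ 1 (fun x : E => ContinuousMap.const (Icc a b) x) := by
      let l : E →L[ℝ] C(Icc a b, E) := LinearMap.mkContinuous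
        { toFun := fun x => ContinuousMap.const (Icc a b) x
          map_add' := fun _ _ => rfl
          map_smul' := fun _ _ => rfl } 1 fun x => by
            rw [one_mul]
            exact (ContinuousMap.norm_le _ (norm_nonneg _)).2 fun t => le_rfl
      exact l.contDiff
    have h1 := (ContinuousMap.evalCLM ℝ (⟨a, ha⟩ : Icc a b) :
      C(Icc a b, E) →L[ℝ] E).contDiff.comp (hQs.comp hconst)
    have h2 : (fun x => IccExtend hab (γ x) a) = (fun x => γ x ⟨a, ha⟩) := by
      funext x; exact hext x a ha
    rw [h2]
    exact h1
  refine ⟨fun x => IccExtend hab (γ x), fun x => (γ x).continuous.Icc_extend', hsol, hdiff,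
    fun x => ?_, hlip', fun c hc hcs => ?_⟩
  · have hd := (hdiff.differentiable one_ne_zero x).hasFDerivAt
    -- The displacement is a Picard integral, with Lipschitz constant `1/4` in the curve, and the
    -- curve is `2`-Lipschitz in `x`. So the differential is within `1/2` of the identity, hence
    -- injective.
    have hl : LipschitzWith (1 / 2 : ℝ≥0) (fun x => IccExtend hab (γ x) a - x) := by
      refine LipschitzWith.of_dist_le_mul fun y z => ?_
      rw [dist_eq_norm, dist_eq_norm, hext y a ha, hext z a ha, hγ y, hγ z]
      have : ((ContinuousMap.const (Icc a b) y + picard hab hg hu (γ y)) ⟨a, ha⟩ - y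
          - ((ContinuousMap.const (Icc a b) z + picard hab hg hu (γ z)) ⟨a, ha⟩ - z))
          = (picard hab hg hu (γ y) - picard hab hg hu (γ z)) ⟨a, ha⟩ := by
        simp
      rw [this]
      refine ((picard hab hg hu (γ y) - picard hab hg hu (γ z)).norm_coe_le_norm _).trans ?_
      refine (norm_picard_sub_le hab hg hu hL _ _).trans ?_
      calc L * (b - a) * ‖γ y - γ z‖ ≤ 1 / 4 * (2 * ‖y - z‖) := by
            gcongr
            exact hlip z y
        _ = _ := by norm_num; ring
    have hd' := hd.sub (hasFDerivAt_id x)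
    have hn := hd'.le_of_lipschitz hl
    rw [injective_iff_map_eq_zero]
    intro h hh
    have h1 := (fderiv ℝ (fun x => IccExtend hab (γ x) a) x
      - ContinuousLinearMap.id ℝ E).le_of_opNorm_le hn h
    rw [sub_apply, hh, zero_sub, norm_neg] at h1
    have : ‖h‖ ≤ 1 / 2 * ‖h‖ := by simpa using h1
    exact norm_le_zero_iff.mp (by linarith [norm_nonneg h])
  · let c' : C(Icc a b, E) := ⟨(Icc a b).domRestrict c, hc.domRestrict⟩
    have hce : ∀ t ∈ Icc a b, IccExtend hab c' t = c t := fun t ht => IccExtend_of_mem hab _ ht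
    have : Q c' = ContinuousMap.const _ (c b) := by
      rw [hQ]
      ext t
      have h1 : picard hab hg hu c' t = ∫ s in b..t, g (c s) (u s) := by
        change (∫ s in b..t, _) = _
        refine intervalIntegral.integral_congr fun s hs => ?_
        rw [uIcc_of_ge t.2.2] at hs
        simp only [hce s ⟨t.2.1.trans hs.1, hs.2⟩]
      rw [ContinuousMap.sub_apply, h1]
      change c t - _ = c b
      rw [hcs t t.2]; abel
    have h2 : c' = γ (c b) := by rw [← Q.symm_apply_apply c', this]
    intro t ht
    rw [← hce t ht, h2]

end Flow

end LipschitzFamily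

/-! ### Controlled fields and trajectories read in charts. -/

section Charts

section PartialDerivative

variable {E G F : Type*} [NormedAddCommGroup E] [NormedSpace ℝ E] [NormedAddCommGroup G]
  [NormedSpace ℝ G] [NormedAddCommGroup F] [NormedSpace ℝ F]

/-- The set `V` is arbitrary, so derivatives within `O ×ˢ V` need not be unique. On a slice `O ×
{v}` they restrict to a genuine derivative because `O` is open; thus any locally continuous choice
of derivatives within the product yields the same, continuous, partial derivative. -/
theorem exists_partial_derivative {f : E → G → F} {O : Set E} {V : Set G} (hO : IsOpen O)
    (hf : ContDiffOn ℝ 1 (fun q : E × G => f q.1 q.2) (O ×ˢ V)) :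
    ContinuousOn (fun q : E × G => fderiv ℝ (fun w => f w q.2) q.1) (O ×ˢ V) ∧
      ∀ w ∈ O, ∀ v ∈ V, HasFDerivAt (fun w => f w v) (fderiv ℝ (fun w => f w v) w) w := by
  have key : ∀ q ∈ O ×ˢ V, ∀ T : E × G →L[ℝ] F,
      HasFDerivWithinAt (fun q : E × G => f q.1 q.2) T (O ×ˢ V) q →
      HasFDerivAt (fun w => f w q.2) (T.comp (ContinuousLinearMap.inl ℝ E G)) q.1 := by
    intro q hq T hT
    have h1 : HasFDerivWithinAt (fun w : E => (w, q.2)) (ContinuousLinearMap.inl ℝ E G) O q.1 :=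
      (hasFDerivAt_prodMk_left q.1 q.2).hasFDerivWithinAt
    have h2 := HasFDerivWithinAt.comp (f := fun w : E => (w, q.2)) (t := O ×ˢ V) q.1 hT h1
      (fun w hw => ⟨hw, hq.2⟩)
    exact h2.hasFDerivAt (hO.mem_nhds hq.1)
  constructor
  · intro q hq
    have h1 := hf q hq
    rw [show (1 : ℕ∞ω) = 0 + 1 from rfl,
      contDiffWithinAt_succ_iff_hasFDerivWithinAt' (by simp)] at h1
    obtain ⟨N, hN, -, -, T, hT, hTc⟩ := h1
    rw [insert_eq_of_mem hq] at hN
    have h2 : ContinuousWithinAt (fun p => (T p).comp (ContinuousLinearMap.inl ℝ E G))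
        (O ×ˢ V) q := hTc.continuousWithinAt.clm_comp continuousWithinAt_const
    have h3 : ∀ p ∈ N ∩ O ×ˢ V, fderiv ℝ (fun w => f w p.2) p.1
        = (T p).comp (ContinuousLinearMap.inl ℝ E G) := fun p hp =>
      (key p hp.2 (T p) (hT p hp.1)).fderiv
    refine h2.congr_of_eventuallyEq ?_ (h3 q ⟨mem_of_mem_nhdsWithin hq hN, hq⟩)
    filter_upwards [hN, self_mem_nhdsWithin] with p hp hp' using h3 p ⟨hp, hp'⟩
  · intro w hw v hv
    have h1 := (hf (w, v) ⟨hw, hv⟩).differentiableWithinAt one_ne_zero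
    exact (key (w, v) ⟨hw, hv⟩ _ h1.hasFDerivWithinAt).differentiableAt.hasFDerivAt

end PartialDerivative

variable {E : Type*} [NormedAddCommGroup E] [NormedSpace ℝ E]
    {M : Type*} [TopologicalSpace M] [ChartedSpace E M] [IsManifold 𝓘(ℝ, E) ∞ M] {m : ℕ}
    {F : (x : M) → EuclideanSpace ℝ (Fin m) → TangentSpace 𝓘(ℝ, E) x}
    {V : Set (EuclideanSpace ℝ (Fin m))}

/-- Expression of a controlled vector field in the chart at `x₀`. -/
noncomputable def chartField (F : (x : M) → EuclideanSpace ℝ (Fin m) → TangentSpace 𝓘(ℝ, E) x)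
    (x₀ : M) (w : E) (v : EuclideanSpace ℝ (Fin m)) : E :=
  mfderiv 𝓘(ℝ, E) 𝓘(ℝ, E) (chartAt E x₀) ((chartAt E x₀).symm w) (F ((chartAt E x₀).symm w) v)

theorem contDiffOn_chartField (hF : SmoothOn F V) (x₀ : M) :
    ContDiffOn ℝ 1 (fun q : E × EuclideanSpace ℝ (Fin m) => chartField F x₀ q.1 q.2)
      ((chartAt E x₀).target ×ˢ V) := by
  have : IsManifold 𝓘(ℝ, E) 1 M := IsManifold.of_le (n := ∞) (by simp)
  rintro ⟨w, v⟩ ⟨hw, hv⟩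
  have hp : (chartAt E x₀).symm w ∈ (chartAt E x₀).source := (chartAt E x₀).map_target hw
  have h1 := hF ((chartAt E x₀).symm w, v) ⟨mem_univ _, hv⟩
  have h2 := ((trivializationAt E (TangentSpace 𝓘(ℝ, E)) x₀).contMDiffWithinAt_iff
    (by rw [Bundle.Trivialization.mem_source]; simpa using hp)).1 h1
  have h3 : ContMDiffWithinAt 𝓘(ℝ, E × EuclideanSpace ℝ (Fin m))
      (𝓘(ℝ, E).prod 𝓘(ℝ, EuclideanSpace ℝ (Fin m))) ∞
      (fun q : E × EuclideanSpace ℝ (Fin m) => ((chartAt E x₀).symm q.1, q.2))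
      ((chartAt E x₀).target ×ˢ V) (w, v) := by
    refine ContMDiffWithinAt.prodMk ?_ ?_
    · exact (contMDiffOn_chart_symm (I := 𝓘(ℝ, E)) (x := x₀) w hw).comp (w, v)
        (contDiff_fst.contMDiff (w, v)).contMDiffWithinAt (fun q hq => hq.1)
    · exact (contDiff_snd.contMDiff (w, v)).contMDiffWithinAt
  have h4 := (ContMDiffWithinAt.comp (w, v) (t := univ ×ˢ V) h2.2 h3
    (fun q hq => ⟨mem_univ _, hq.2⟩)).contDiffWithinAt
  refine (h4.of_le (by simp)).congr_of_mem ?_ ⟨hw, hv⟩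
  rintro ⟨w', v'⟩ ⟨hw', hv'⟩
  have hp' : (chartAt E x₀).symm w' ∈ (chartAt E x₀).source := (chartAt E x₀).map_target hw'
  -- The fibre coordinate of the trivialization at `x₀` is the differential of the chart, so the
  -- smooth map `h4` is the chart expression of `F`.
  have h5 := TangentBundle.continuousLinearMapAt_trivializationAt (I := 𝓘(ℝ, E)) hp'
  simp only [chartField, Function.comp]
  have h6 : extChartAt 𝓘(ℝ, E) x₀ = (chartAt E x₀).toPartialEquiv := by simp [mfld_simps]
  have h7 : (trivializationAt E (TangentSpace 𝓘(ℝ, E)) x₀).continuousLinearMapAt ℝ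
      ((chartAt E x₀).symm w') (F ((chartAt E x₀).symm w') v')
      = ((trivializationAt E (TangentSpace 𝓘(ℝ, E)) x₀)
        ⟨(chartAt E x₀).symm w', F ((chartAt E x₀).symm w') v'⟩).2 := by
    rw [Bundle.Trivialization.continuousLinearMapAt_apply,
      Bundle.Trivialization.linearMapAt_apply, if_pos]
    simpa using hp'
  rw [← h7, h5, h6]
  rfl

theorem hasDerivAt_chart_comp {γ : ℝ → M} {t : ℝ} {v : EuclideanSpace ℝ (Fin m)} (x₀ : M)
    (ht : γ t ∈ (chartAt E x₀).source)
    (h : HasMFDerivAt 𝓘(ℝ, ℝ) 𝓘(ℝ, E) γ t ((1 : ℝ →L[ℝ] ℝ).smulRight (F (γ t) v))) :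
    HasDerivAt (fun s => chartAt E x₀ (γ s)) (chartField F x₀ (chartAt E x₀ (γ t)) v) t := by
  have : IsManifold 𝓘(ℝ, E) 1 M := IsManifold.of_le (n := ∞) (by simp)
  have h1 := (mdifferentiableAt_atlas (I := 𝓘(ℝ, E)) (chart_mem_atlas E x₀) ht).hasMFDerivAt
  let L : E →L[ℝ] E := mfderiv 𝓘(ℝ, E) 𝓘(ℝ, E) (chartAt E x₀) (γ t)
  let X : E := F (γ t) v
  have h2 : HasFDerivAt (fun s => chartAt E x₀ (γ s)) (L.comp ((1 : ℝ →L[ℝ] ℝ).smulRight X)) t :=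
    (h1.comp t h).hasFDerivAt
  have h3 : L X = chartField F x₀ (chartAt E x₀ (γ t)) v :=
    congrArg (fun z => (mfderiv 𝓘(ℝ, E) 𝓘(ℝ, E) (chartAt E x₀) z (F z v) : E))
      ((chartAt E x₀).left_inv ht).symm
  have h4 := h2.hasDerivAt
  rw [← h3]
  simpa using h4

theorem hasMFDerivAt_symm_chart_comp {c : ℝ → E} {t : ℝ} {v : EuclideanSpace ℝ (Fin m)} (x₀ : M)
    (ht : c t ∈ (chartAt E x₀).target) (h : HasDerivAt c (chartField F x₀ (c t) v) t) :
    HasMFDerivAt 𝓘(ℝ, ℝ) 𝓘(ℝ, E) (fun s => (chartAt E x₀).symm (c s)) t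
      ((1 : ℝ →L[ℝ] ℝ).smulRight (F ((chartAt E x₀).symm (c t)) v)) := by
  have : IsManifold 𝓘(ℝ, E) 1 M := IsManifold.of_le (n := ∞) (by simp)
  have h1 := (mdifferentiableAt_atlas_symm (I := 𝓘(ℝ, E)) (chart_mem_atlas E x₀) ht).hasMFDerivAt
  have h2 := h1.comp t h.hasFDerivAt.hasMFDerivAt
  refine h2.congr_mfderiv ?_
  have h3 := (mdifferentiable_chart (I := 𝓘(ℝ, E)) x₀).symm_comp_deriv
    ((chartAt E x₀).map_target ht)
  rw [(chartAt E x₀).right_inv ht] at h3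
  have h4 := DFunLike.congr_fun h3 (F ((chartAt E x₀).symm (c t)) v)
  let L : E →L[ℝ] E := mfderiv 𝓘(ℝ, E) 𝓘(ℝ, E) (chartAt E x₀).symm (c t)
  let X : E := F ((chartAt E x₀).symm (c t)) v
  have h5 : L (chartField F x₀ (c t) v) = X := h4
  change L.comp (ContinuousLinearMap.toSpanSingleton ℝ (chartField F x₀ (c t) v))
    = (1 : ℝ →L[ℝ] ℝ).smulRight X
  ext
  simp [h5]

omit [IsManifold 𝓘(ℝ, E) ∞ M] in
theorem hasMFDerivAt_congr_curve {γ γ' : ℝ → M} {t : ℝ} {v : EuclideanSpace ℝ (Fin m)}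
    (h : HasMFDerivAt 𝓘(ℝ, ℝ) 𝓘(ℝ, E) γ t ((1 : ℝ →L[ℝ] ℝ).smulRight (F (γ t) v)))
    (heq : γ' =ᶠ[𝓝 t] γ) :
    HasMFDerivAt 𝓘(ℝ, ℝ) 𝓘(ℝ, E) γ' t ((1 : ℝ →L[ℝ] ℝ).smulRight (F (γ' t) v)) := by
  have h1 : ((1 : ℝ →L[ℝ] ℝ).smulRight (F (γ t) v : E) : ℝ →L[ℝ] E)
      = (1 : ℝ →L[ℝ] ℝ).smulRight (F (γ' t) v : E) :=
    congrArg (fun z => ((1 : ℝ →L[ℝ] ℝ).smulRight (F z v : E) : ℝ →L[ℝ] E)) heq.eq_of_nhds.symm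
  exact (h.congr_of_eventuallyEq heq).congr_mfderiv h1

theorem contDiffAt_coordChange (x₀ x₁ : M) {w : E} (hw : w ∈ (chartAt E x₀).target)
    (hw' : (chartAt E x₀).symm w ∈ (chartAt E x₁).source) :
    ContDiffAt ℝ 1 (fun z => chartAt E x₁ ((chartAt E x₀).symm z)) w := by
  have : IsManifold 𝓘(ℝ, E) 1 M := IsManifold.of_le (n := ∞) (by simp)
  have h := contDiffWithinAt_ext_coord_change (I := 𝓘(ℝ, E)) (n := 1) x₁ x₀ (y := w)
    (by simp [mfld_simps, hw, hw'])
  simpa [Function.comp_def, contDiffWithinAt_univ] using h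

/-- Absolute continuity must be checked in every chart. Transition maps are `C¹`, hence locally
Lipschitz, so the curve read in another chart is locally Lipschitz on a compact interval, hence
Lipschitz. -/
theorem absolutelyContinuousCurve_of_chart {c : ℝ → E} {T : ℝ} (x₀ : M) {C : ℝ≥0}
    (hc : LipschitzOnWith C c (Icc 0 T)) (hmaps : MapsTo c (Icc 0 T) (chartAt E x₀).target) :
    AbsolutelyContinuousCurve E T (fun t => (chartAt E x₀).symm (c t)) := by
  refine ⟨(chartAt E x₀).continuousOn_symm.comp hc.continuousOn hmaps, ?_⟩
  intro x₁ a b ha hab hb hmaps'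
  have hsub : Icc a b ⊆ Icc 0 T := Icc_subset_Icc ha hb
  have hloc : LocallyLipschitzOn (Icc a b)
      (fun t => chartAt E x₁ ((chartAt E x₀).symm (c t))) := by
    intro t ht
    obtain ⟨K, N, hN, hK⟩ := (contDiffAt_coordChange x₀ x₁ (hmaps (hsub ht))
      (hmaps' ht)).exists_lipschitzOnWith
    refine ⟨K * C, Icc a b ∩ c ⁻¹' N, ?_, ?_⟩
    · exact inter_mem self_mem_nhdsWithin ((hc.continuousOn.mono hsub) t ht hN)
    · exact hK.comp (hc.mono (inter_subset_left.trans hsub)) (fun s hs => hs.2)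
  obtain ⟨K, hK⟩ := hloc.exists_lipschitzOnWith_of_compact isCompact_Icc
  rw [← uIcc_of_le hab] at hK
  exact hK.absolutelyContinuousOnInterval

theorem mem_attainableSet_of_chart_curve {𝒰 : ℝ → Set (ℝ → EuclideanSpace ℝ (Fin m))}
    {c : ℝ → E} {T : ℝ} (hT : 0 ≤ T) (x₀ : M) {C : ℝ≥0}
    (hc : LipschitzOnWith C c (Icc 0 T)) (hmaps : MapsTo c (Icc 0 T) (chartAt E x₀).target)
    {u : ℝ → EuclideanSpace ℝ (Fin m)} (hu : u ∈ 𝒰 T)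
    (hd : ∀ᵐ t ∂(volume.restrict (Icc 0 T)), HasDerivAt c (chartField F x₀ (c t) (u t)) t) :
    (chartAt E x₀).symm (c T) ∈ attainableSet F 𝒰 ((chartAt E x₀).symm (c 0)) := by
  refine ⟨T, hT, u, hu, fun t => (chartAt E x₀).symm (c t),
    ⟨absolutelyContinuousCurve_of_chart x₀ hc hmaps, ?_⟩, rfl, rfl⟩
  filter_upwards [hd, ae_restrict_mem measurableSet_Icc] with t ht htm
  exact hasMFDerivAt_symm_chart_comp x₀ (hmaps htm) ht

theorem IsTrajectory.chart_curve {T : ℝ} {u : ℝ → EuclideanSpace ℝ (Fin m)} {γ : ℝ → M}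
    (h : IsTrajectory F T u γ) (x₀ : M) {a b : ℝ} (ha : 0 ≤ a) (hab : a ≤ b) (hb : b ≤ T)
    (hmaps : MapsTo γ (Icc a b) (chartAt E x₀).source) :
    AbsolutelyContinuousOnInterval (fun t => chartAt E x₀ (γ t)) a b ∧
    ∀ᵐ t ∂(volume.restrict (Icc a b)), HasDerivAt (fun t => chartAt E x₀ (γ t))
      (chartField F x₀ (chartAt E x₀ (γ t)) (u t)) t := by
  refine ⟨h.1.2 x₀ a b ha hab hb hmaps, ?_⟩
  filter_upwards [ae_restrict_of_ae_restrict_of_subset (Icc_subset_Icc ha hb) h.2,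
    ae_restrict_mem measurableSet_Icc] with t ht htm
  exact hasDerivAt_chart_comp x₀ (hmaps htm) ht

omit [IsManifold 𝓘(ℝ, E) ∞ M] in
theorem AbsolutelyContinuousCurve.trans {T₁ T₂ : ℝ} (h₁ : 0 ≤ T₁) (h₂ : 0 ≤ T₂) {γ₁ γ₂ : ℝ → M}
    (hγ₁ : AbsolutelyContinuousCurve E T₁ γ₁) (hγ₂ : AbsolutelyContinuousCurve E T₂ γ₂)
    (heq : γ₁ T₁ = γ₂ 0) :
    AbsolutelyContinuousCurve E (T₁ + T₂) (fun t => if t ≤ T₁ then γ₁ t else γ₂ (t - T₁)) := by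
  have e1 : EqOn γ₁ (fun t => if t ≤ T₁ then γ₁ t else γ₂ (t - T₁)) (Iic T₁) := fun t ht => by
    simp [mem_Iic.1 ht]
  have e2 : EqOn (fun t => γ₂ (t - T₁)) (fun t => if t ≤ T₁ then γ₁ t else γ₂ (t - T₁))
      (Ici T₁) := fun t ht => by
    rcases (mem_Ici.1 ht).eq_or_lt with rfl | h
    · simp [heq]
    · simp [not_le.2 h]
  set γ : ℝ → M := fun t => if t ≤ T₁ then γ₁ t else γ₂ (t - T₁) with hγ
  constructor
  · have c1 : ContinuousOn γ (Icc 0 T₁) := hγ₁.1.congr fun t ht => (e1 ht.2).symm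
    have c2 : ContinuousOn γ (Icc T₁ (T₁ + T₂)) := by
      have : ContinuousOn (fun t => γ₂ (t - T₁)) (Icc T₁ (T₁ + T₂)) :=
        hγ₂.1.comp (by fun_prop) fun t ht => ⟨by linarith [ht.1], by linarith [ht.2]⟩
      exact this.congr fun t ht => (e2 ht.1).symm
    rw [← Icc_union_Icc_eq_Icc h₁ (by linarith : T₁ ≤ T₁ + T₂)]
    exact c1.union_of_isClosed c2 isClosed_Icc isClosed_Icc
  · intro x a b ha hab hb hmaps
    have left : ∀ p q, 0 ≤ p → p ≤ q → q ≤ T₁ → MapsTo γ (Icc p q) (chartAt E x).source →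
        AbsolutelyContinuousOnInterval (fun t => chartAt E x (γ t)) p q := by
      intro p q hp hpq hq hm
      refine absolutelyContinuousOnInterval_congr (hγ₁.2 x p q hp hpq hq fun t ht => ?_)
        fun t ht => ?_
      · rw [e1 (ht.2.trans hq)]; exact hm ht
      · rw [uIcc_of_le hpq] at ht
        simp only [e1 (ht.2.trans hq)]
    have right : ∀ p q, T₁ ≤ p → p ≤ q → q ≤ T₁ + T₂ → MapsTo γ (Icc p q) (chartAt E x).source →
        AbsolutelyContinuousOnInterval (fun t => chartAt E x (γ t)) p q := by
      intro p q hp hpq hq hm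
      have h3 := hγ₂.2 x (p - T₁) (q - T₁) (by linarith) (by linarith) (by linarith)
        (fun t ht => by
          have := e2 (x := t + T₁) (mem_Ici.2 (by linarith [ht.1]))
          simp only [add_sub_cancel_right] at this
          rw [this]
          exact hm ⟨by linarith [ht.1], by linarith [ht.2]⟩)
      have h4 := absolutelyContinuousOnInterval_comp (φ := fun t => t - T₁) (a := p) (b := q) h3
        (fun s t hst => by simpa using hst) (fun s t => by simp)
        (fun t ht => by
          rw [uIcc_of_le hpq] at ht
          rw [uIcc_of_le (by linarith)]
          exact ⟨by linarith [ht.1], by linarith [ht.2]⟩)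
      refine absolutelyContinuousOnInterval_congr h4 fun t ht => ?_
      rw [uIcc_of_le hpq] at ht
      simp only [Function.comp, ← e2 (mem_Ici.2 (hp.trans ht.1))]
    rcases le_total b T₁ with hbT | hbT
    · exact left a b ha hab hbT hmaps
    rcases le_total T₁ a with haT | haT
    · exact right a b haT hab hb hmaps
    · exact absolutelyContinuousOnInterval_trans haT hbT
        (left a T₁ ha haT le_rfl (hmaps.mono_left (Icc_subset_Icc_right hbT)))
        (right T₁ b le_rfl hbT hb (hmaps.mono_left (Icc_subset_Icc_left haT)))

omit [IsManifold 𝓘(ℝ, E) ∞ M] in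
theorem IsTrajectory.trans {T₁ T₂ : ℝ} (h₁ : 0 ≤ T₁) (h₂ : 0 ≤ T₂) {γ₁ γ₂ : ℝ → M}
    {u₁ u₂ : ℝ → EuclideanSpace ℝ (Fin m)}
    (hγ₁ : IsTrajectory F T₁ u₁ γ₁) (hγ₂ : IsTrajectory F T₂ u₂ γ₂) (heq : γ₁ T₁ = γ₂ 0) :
    IsTrajectory F (T₁ + T₂) (fun t => if t ≤ T₁ then u₁ t else u₂ (t - T₁))
      (fun t => if t ≤ T₁ then γ₁ t else γ₂ (t - T₁)) := by
  refine ⟨hγ₁.1.trans h₁ h₂ hγ₂.1 heq, ?_⟩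
  have d1 := (ae_restrict_iff' measurableSet_Icc).1 hγ₁.2
  have d2 := (ae_restrict_iff' measurableSet_Icc).1 hγ₂.2
  have d2' := (measurePreserving_sub_right volume T₁).quasiMeasurePreserving.ae d2
  rw [ae_restrict_iff' measurableSet_Icc]
  -- The concatenated curve may have a corner at the junction, which is a null set.
  have hne : ∀ᵐ t : ℝ, t ≠ T₁ := by simp [ae_iff]
  filter_upwards [d1, d2', hne] with t h1 h2 hne ht
  rcases lt_or_gt_of_ne hne with hlt | hlt
  · have := h1 ⟨ht.1, hlt.le⟩
    simp only [if_pos hlt.le]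
    refine hasMFDerivAt_congr_curve (F := F) this ?_
    filter_upwards [gt_mem_nhds hlt] with s hs
    simp [le_of_lt hs]
  · have := h2 ⟨by linarith, by linarith [ht.2]⟩
    simp only [if_neg (not_le.2 hlt)]
    have hs : HasMFDerivAt 𝓘(ℝ, ℝ) 𝓘(ℝ, ℝ) (fun s : ℝ => s - T₁) t (1 : ℝ →L[ℝ] ℝ) :=
      ((hasFDerivAt_id (𝕜 := ℝ) t).sub_const T₁).hasMFDerivAt
    have h3 := HasMFDerivAt.comp t this hs
    refine hasMFDerivAt_congr_curve (F := F) (γ := γ₂ ∘ fun s => s - T₁) h3 ?_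
    filter_upwards [lt_mem_nhds hlt] with s hs
    simp [not_le.2 hs]

end Charts

/-! ### Cutoff fields, admissible classes of controls and immersed discs. -/

section AdmissibleClass

section Cutoff

variable {E G : Type*} [NormedAddCommGroup E] [NormedSpace ℝ E] [FiniteDimensional ℝ E]
  [NormedAddCommGroup G] [NormedSpace ℝ G]

omit [NormedSpace ℝ E] [FiniteDimensional ℝ E] in
theorem continuous_of_continuousOn_of_eq_zero {X K : Type*} [TopologicalSpace K]
    [NormedAddCommGroup X] {h : E × K → X} {O C : Set E} (hO : IsOpen O) (hC : IsClosed C)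
    (hCO : C ⊆ O) (h₁ : ContinuousOn h (O ×ˢ univ)) (h₂ : ∀ p : E × K, p.1 ∉ C → h p = 0) :
    Continuous h := by
  rw [continuous_iff_continuousAt]
  intro p
  by_cases hp : p.1 ∈ O
  · exact h₁.continuousAt ((hO.prod isOpen_univ).mem_nhds ⟨hp, mem_univ _⟩)
  · have : h =ᶠ[𝓝 p] fun _ => 0 := by
      have hN : Cᶜ ∈ 𝓝 p.1 := hC.isOpen_compl.mem_nhds fun h => hp (hCO h)
      filter_upwards [continuous_fst.continuousAt.preimage_mem_nhds hN] with q hq using h₂ q hq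
    exact this.continuousAt

/-- A controlled vector field which is `C¹` on an open set coincides near a given point, for
controls in a compact set, with a bounded Lipschitz family of vector fields. -/
theorem exists_isLipschitzFamily {f : E → G → E} {O : Set E} {V K : Set G} (hO : IsOpen O)
    (hf : ContDiffOn ℝ 1 (fun q : E × G => f q.1 q.2) (O ×ˢ V)) (hK : IsCompact K) (hKV : K ⊆ V)
    {x₀ : E} (hx₀ : x₀ ∈ O) :
    ∃ ρ > 0, Metric.ball x₀ ρ ⊆ O ∧ ∃ (g : E → K → E) (g' : E → K → E →L[ℝ] E) (L C : ℝ),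
      0 ≤ L ∧ 0 ≤ C ∧ IsLipschitzFamily g g' L ∧ (∀ x k, ‖g x k‖ ≤ C) ∧
      ∀ x ∈ Metric.ball x₀ ρ, ∀ k : K, g x k = f x k := by
  have : ProperSpace E := FiniteDimensional.proper ℝ E
  have : CompactSpace K := isCompact_iff_compactSpace.1 hK
  obtain ⟨hc', hd⟩ := exists_partial_derivative hO hf
  obtain ⟨r, hr, hrO⟩ := Metric.isOpen_iff.1 hO x₀ hx₀
  -- Multiplying by a bump equal to `1` on the ball of radius `r / 4` and supported in a compact
  -- ball inside `O` makes the field and its derivative globally continuous. With `K` compact, both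
  -- are then bounded.
  let χ : ContDiffBump x₀ := ⟨r / 4, r / 2, by positivity, by linarith⟩
  have hCO : Metric.closedBall x₀ (r / 2) ⊆ O :=
    (Metric.closedBall_subset_ball (by linarith)).trans hrO
  have hχ0 : ∀ x ∉ Metric.closedBall x₀ (r / 2), χ =ᶠ[𝓝 x] fun _ => (0 : ℝ) := by
    intro x hx
    filter_upwards [Metric.isClosed_closedBall.isOpen_compl.mem_nhds hx] with y hy
    refine χ.zero_of_le_dist ?_
    simpa using le_of_lt (by simpa using hy : r / 2 < dist y x₀)
  have hχd : ∀ x, HasFDerivAt χ (fderiv ℝ χ x) x := fun x =>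
    (χ.contDiff.differentiable (n := 1) one_ne_zero x).hasFDerivAt
  have hχd0 : ∀ x ∉ Metric.closedBall x₀ (r / 2), fderiv ℝ χ x = 0 := fun x hx => by
    rw [(hχ0 x hx).fderiv_eq]; simp
  have hχc : Continuous (fderiv ℝ χ) := (χ.contDiff (n := 1)).continuous_fderiv one_ne_zero
  let g : E → K → E := fun x k => χ x • f x k
  let g' : E → K → E →L[ℝ] E := fun x k =>
    χ x • fderiv ℝ (fun w => f w k) x + (fderiv ℝ χ x).smulRight (f x k)
  have hmap : MapsTo (fun p : E × K => (p.1, (p.2 : G))) (O ×ˢ univ) (O ×ˢ V) :=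
    fun p hp => ⟨hp.1, hKV p.2.2⟩
  have hpc : Continuous (fun p : E × K => (p.1, (p.2 : G))) := by fun_prop
  have hfc : ContinuousOn (fun p : E × K => f p.1 p.2) (O ×ˢ univ) :=
    hf.continuousOn.comp hpc.continuousOn hmap
  have hfc' : ContinuousOn (fun p : E × K => fderiv ℝ (fun w => f w p.2) p.1) (O ×ˢ univ) :=
    hc'.comp hpc.continuousOn hmap
  have hg0 : ∀ p : E × K, p.1 ∉ Metric.closedBall x₀ (r / 2) → g p.1 p.2 = 0 := fun p hp => by
    simp [g, (hχ0 p.1 hp).eq_of_nhds]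
  have hg'0 : ∀ p : E × K, p.1 ∉ Metric.closedBall x₀ (r / 2) → g' p.1 p.2 = 0 := fun p hp => by
    simp only [g', (hχ0 p.1 hp).eq_of_nhds, hχd0 p.1 hp, zero_smul, zero_add]
    ext; simp
  have hgc : Continuous fun p : E × K => g p.1 p.2 :=
    continuous_of_continuousOn_of_eq_zero hO Metric.isClosed_closedBall hCO
      ((χ.continuous.comp continuous_fst).continuousOn.smul hfc) hg0
  have hgc' : Continuous fun p : E × K => g' p.1 p.2 := by
    refine continuous_of_continuousOn_of_eq_zero hO Metric.isClosed_closedBall hCO ?_ hg'0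
    refine ((χ.continuous.comp continuous_fst).continuousOn.smul hfc').add ?_
    have h1 := (ContinuousLinearMap.smulRightL ℝ E E).continuous₂
    exact h1.comp_continuousOn ((hχc.comp continuous_fst).continuousOn.prodMk hfc)
  have bound : ∀ {X : Type _} [NormedAddCommGroup X] (h : E × K → X), Continuous h →
      (∀ p : E × K, p.1 ∉ Metric.closedBall x₀ (r / 2) → h p = 0) →
      ∃ C, 0 ≤ C ∧ ∀ p, ‖h p‖ ≤ C := by
    intro X _ h hh h0
    obtain ⟨C, hC⟩ := ((isCompact_closedBall x₀ (r / 2)).prod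
      (isCompact_univ (X := K))).exists_bound_of_continuousOn hh.continuousOn
    refine ⟨max C 0, le_max_right _ _, fun p => ?_⟩
    by_cases hp : p.1 ∈ Metric.closedBall x₀ (r / 2)
    · exact (hC p ⟨hp, mem_univ _⟩).trans (le_max_left _ _)
    · rw [h0 p hp, norm_zero]; exact le_max_right _ _
  obtain ⟨C, hC0, hC⟩ := bound _ hgc hg0
  obtain ⟨L, hL0, hL⟩ := bound _ hgc' hg'0
  refine ⟨r / 4, by positivity, (Metric.ball_subset_ball (by linarith)).trans hrO, g, g', L, C,
    hL0, hC0, ⟨hgc, hgc', fun x k => ?_, fun x k => hL (x, k)⟩, fun x k => hC (x, k), ?_⟩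
  · by_cases hx : x ∈ O
    · exact (hχd x).smul (hd x hx k (hKV k.2))
    · have hx' : x ∉ Metric.closedBall x₀ (r / 2) := fun h => hx (hCO h)
      rw [hg'0 (x, k) hx']
      have : (fun y => g y k) =ᶠ[𝓝 x] fun _ => (0 : E) := by
        filter_upwards [hχ0 x hx'] with y hy
        simp [g, hy]
      exact (hasFDerivAt_const (0 : E) x).congr_of_eventuallyEq this
  · intro x hx k
    have : χ x = 1 := χ.one_of_mem_closedBall (Metric.ball_subset_closedBall hx)
    simp [g, this]

/-- The flow requires a control with values in the compact space `K` at every time: take a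
measurable representative and replace its values outside `K` by a fixed point of `K`. -/
theorem exists_stronglyMeasurable_subtype {m : ℕ} {u : ℝ → EuclideanSpace ℝ (Fin m)}
    {K : Set (EuclideanSpace ℝ (Fin m))} (hK : IsCompact K) (hKne : K.Nonempty) {μ : Measure ℝ}
    (hu : AEStronglyMeasurable u μ) (huK : ∀ᵐ t ∂μ, u t ∈ K) :
    ∃ u' : ℝ → K, StronglyMeasurable u' ∧ ∀ᵐ t ∂μ, (u' t : EuclideanSpace ℝ (Fin m)) = u t := by
  classical
  obtain ⟨k₀, hk₀⟩ := hKne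
  let w := hu.mk u
  have hw : Measurable w := hu.stronglyMeasurable_mk.measurable
  let p : ℝ → EuclideanSpace ℝ (Fin m) := fun t => if w t ∈ K then w t else k₀
  have hp : ∀ t, p t ∈ K := fun t => by
    by_cases h : w t ∈ K
    · simp [p, h]
    · simpa [p, h] using hk₀
  have hpm : Measurable p := Measurable.ite (hw hK.isClosed.measurableSet) hw measurable_const
  refine ⟨fun t => ⟨p t, hp t⟩, (hpm.subtype_mk).stronglyMeasurable, ?_⟩
  filter_upwards [huK, hu.ae_eq_mk] with t h1 h2
  have h3 : w t = u t := h2.symm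
  simp only [p, h3, if_pos h1]

end Cutoff

variable {E : Type*} [NormedAddCommGroup E] [NormedSpace ℝ E]
    {M : Type*} [TopologicalSpace M] [ChartedSpace E M] [IsManifold 𝓘(ℝ, E) ∞ M] {m : ℕ}
    {F : (x : M) → EuclideanSpace ℝ (Fin m) → TangentSpace 𝓘(ℝ, E) x}
    {U V : Set (EuclideanSpace ℝ (Fin m))} {𝒰 : ℝ → Set (ℝ → EuclideanSpace ℝ (Fin m))}

/-- A class of controls with values in `U`, stable under restriction and concatenation, containing
the constant controls, each control being essentially valued in a compact subset of `V`. -/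
structure IsAdmissibleClass (U V : Set (EuclideanSpace ℝ (Fin m)))
    (𝒰 : ℝ → Set (ℝ → EuclideanSpace ℝ (Fin m))) : Prop where
  subset : U ⊆ V
  restrict : ∀ {T : ℝ} {u}, u ∈ 𝒰 T → ∀ {s t : ℝ}, 0 ≤ s → s ≤ t → t ≤ T →
    (fun r => u (r + s)) ∈ 𝒰 (t - s)
  concat : ∀ {T₁ T₂ : ℝ} {u₁ u₂}, 0 ≤ T₁ → 0 ≤ T₂ → u₁ ∈ 𝒰 T₁ → u₂ ∈ 𝒰 T₂ →
    (fun t => if t ≤ T₁ then u₁ t else u₂ (t - T₁)) ∈ 𝒰 (T₁ + T₂)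
  const : ∀ {v}, v ∈ U → ∀ {T : ℝ}, 0 ≤ T → (fun _ => v) ∈ 𝒰 T
  aestronglyMeasurable : ∀ {T : ℝ} {u}, u ∈ 𝒰 T → AEStronglyMeasurable u (volume.restrict (Icc 0 T))
  ae_mem : ∀ {T : ℝ} {u}, u ∈ 𝒰 T → ∀ᵐ t ∂(volume.restrict (Icc 0 T)), u t ∈ U
  exists_compact : ∀ {T : ℝ} {u}, u ∈ 𝒰 T → ∃ K, IsCompact K ∧ K ⊆ V ∧
    ∀ᵐ t ∂(volume.restrict (Icc 0 T)), u t ∈ K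

omit [IsManifold 𝓘(ℝ, E) ∞ M] in
theorem IsAdmissibleClass.attainableSet_trans (h𝒰 : IsAdmissibleClass U V 𝒰) {x y z : M}
    (hxy : y ∈ attainableSet F 𝒰 x) (hyz : z ∈ attainableSet F 𝒰 y) :
    z ∈ attainableSet F 𝒰 x := by
  obtain ⟨T₁, hT₁, u₁, hu₁, γ₁, hγ₁, h10, h1T⟩ := hxy
  obtain ⟨T₂, hT₂, u₂, hu₂, γ₂, hγ₂, h20, h2T⟩ := hyz
  refine ⟨T₁ + T₂, add_nonneg hT₁ hT₂, _, h𝒰.concat hT₁ hT₂ hu₁ hu₂, _,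
    hγ₁.trans hT₁ hT₂ hγ₂ (h1T.trans h20.symm), ?_, ?_⟩
  · simp [hT₁, h10]
  · rcases hT₂.eq_or_lt with rfl | h
    · simp [h1T, ← h2T, h20]
    · simp [h, h2T]

variable [FiniteDimensional ℝ E]

/-- Turns a solution of the integral equation normalized at the final time `b`, as produced by the
backward flow, into a trajectory starting at time `0`. -/
theorem mem_attainableSet_of_integral_curve {c w : ℝ → E} {a b C : ℝ} (hab : a ≤ b) (x₀ : M)
    {u : ℝ → EuclideanSpace ℝ (Fin m)} (hu : (fun r => u (r + a)) ∈ 𝒰 (b - a))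
    (hw : IntervalIntegrable w volume a b) (hwC : ∀ t, ‖w t‖ ≤ C)
    (hc : ∀ t ∈ Icc a b, c t = c b + ∫ s in b..t, w s)
    (hmaps : MapsTo c (Icc a b) (chartAt E x₀).target)
    (hae : ∀ᵐ t ∂(volume.restrict (Icc a b)), w t = chartField F x₀ (c t) (u t)) :
    (chartAt E x₀).symm (c b) ∈ attainableSet F 𝒰 ((chartAt E x₀).symm (c a)) := by
  have : CompleteSpace E := FiniteDimensional.complete ℝ E
  have hb : b ∈ Icc a b := ⟨hab, le_rfl⟩
  have hC : 0 ≤ C := (norm_nonneg _).trans (hwC a)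
  have hwi : ∀ t ∈ Icc a b, IntervalIntegrable w volume b t := fun t ht =>
    hw.mono_set (by rw [uIcc_of_le hab]; exact uIcc_subset_Icc hb ht)
  have hlip : LipschitzOnWith (Real.toNNReal C) (fun r => c (r + a)) (Icc 0 (b - a)) := by
    refine LipschitzOnWith.of_dist_le_mul fun x hx y hy => ?_
    have hx' : x + a ∈ Icc a b := ⟨by linarith [hx.1], by linarith [hx.2]⟩
    have hy' : y + a ∈ Icc a b := ⟨by linarith [hy.1], by linarith [hy.2]⟩
    rw [dist_eq_norm, hc _ hx', hc _ hy', add_sub_add_left_eq_sub,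
      intervalIntegral.integral_interval_sub_left (hwi _ hx') (hwi _ hy'),
      Real.coe_toNNReal C hC, Real.dist_eq]
    refine (intervalIntegral.norm_integral_le_of_norm_le_const fun s _ => hwC s).trans ?_
    simp
  have hd : ∀ᵐ t, t ∈ Icc a b → HasDerivAt c (chartField F x₀ (c t) (u t)) t := by
    rw [ae_restrict_iff' measurableSet_Icc] at hae
    -- The equation holds only on `[a, b]`, so a two-sided derivative is available only in the
    -- interior.
    have hne : ∀ᵐ t : ℝ, t ≠ a ∧ t ≠ b := by
      have h1 : ∀ᵐ t : ℝ, t ≠ a := by simp [ae_iff]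
      have h2 : ∀ᵐ t : ℝ, t ≠ b := by simp [ae_iff]
      filter_upwards [h1, h2] with t h1 h2 using ⟨h1, h2⟩
    filter_upwards [hae, hne, hw.ae_hasDerivAt_integral] with t h1 h2 h3 ht
    rw [uIcc_of_le hab] at h3
    have h4 := (h3 ht b hb).const_add (c b)
    rw [h1 ht] at h4
    refine h4.congr_of_eventuallyEq ?_
    filter_upwards [Icc_mem_nhds (lt_of_le_of_ne ht.1 h2.1.symm) (lt_of_le_of_ne ht.2 h2.2)]
      with r hr using hc r hr
  have key := mem_attainableSet_of_chart_curve (F := F) (𝒰 := 𝒰) (c := fun r => c (r + a))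
    (sub_nonneg.2 hab) x₀ hlip (fun r hr => hmaps ⟨by linarith [hr.1], by linarith [hr.2]⟩) hu (by
      rw [ae_restrict_iff' measurableSet_Icc]
      filter_upwards [(measurePreserving_add_right volume a).quasiMeasurePreserving.ae hd]
        with r hr hr'
      exact (hr ⟨by linarith [hr'.1], by linarith [hr'.2]⟩).comp_add_const r a)
  simpa using key

omit [FiniteDimensional ℝ E] [IsManifold 𝓘(ℝ, E) ∞ M] in
/-- Points through which there passes an immersed `C¹` disc of dimension `k` contained in `A`. -/
def discPoints (E : Type*) [NormedAddCommGroup E] [NormedSpace ℝ E] {M : Type*}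
    [TopologicalSpace M] [ChartedSpace E M] (A : Set M) (k : ℕ) : Set M :=
  {z | ∃ x₀ : M, z ∈ (chartAt E x₀).source ∧ ∃ Φ : EuclideanSpace ℝ (Fin k) → E,
    ContDiffAt ℝ 1 Φ 0 ∧ Function.Injective (fderiv ℝ Φ 0) ∧ Φ 0 = chartAt E x₀ z ∧
    ∀ᶠ τ in 𝓝 0, (chartAt E x₀).symm (Φ τ) ∈ A}

omit [FiniteDimensional ℝ E] [IsManifold 𝓘(ℝ, E) ∞ M] in
theorem discPoints_subset (A : Set M) (k : ℕ) : discPoints E A k ⊆ A := by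
  rintro z ⟨x₀, hz, Φ, -, -, h0, hA⟩
  have := hA.self_of_nhds
  rwa [h0, (chartAt E x₀).left_inv hz] at this

omit [IsManifold 𝓘(ℝ, E) ∞ M] in
theorem le_finrank_of_discPoints_nonempty {A : Set M} {k : ℕ} (h : (discPoints E A k).Nonempty) :
    k ≤ Module.finrank ℝ E := by
  obtain ⟨z, x₀, hz, Φ, -, hi, -, -⟩ := h
  have := LinearMap.finrank_le_finrank_of_injective
    (f := (fderiv ℝ Φ 0 : EuclideanSpace ℝ (Fin k) →ₗ[ℝ] E)) hi
  simpa using this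

-- The disc may be taken in any chart around `z`: the transition map is `C¹` and, having a `C¹`
-- local inverse, has injective differential.
omit [FiniteDimensional ℝ E] in
theorem exists_disc_of_mem_discPoints {A : Set M} {k : ℕ} {z : M} (hz : z ∈ discPoints E A k)
    {x₁ : M} (hz₁ : z ∈ (chartAt E x₁).source) : ∃ Φ : EuclideanSpace ℝ (Fin k) → E,
    ContDiffAt ℝ 1 Φ 0 ∧ Function.Injective (fderiv ℝ Φ 0) ∧ Φ 0 = chartAt E x₁ z ∧
    ∀ᶠ τ in 𝓝 0, (chartAt E x₁).symm (Φ τ) ∈ A := by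
  obtain ⟨x₀, hz₀, Φ, hΦ, hi, h0, hA⟩ := hz
  set e₀ := chartAt E x₀
  set e₁ := chartAt E x₁
  have ht₀ : e₀ z ∈ e₀.target := e₀.map_source hz₀
  have ht₁ : e₁ z ∈ e₁.target := e₁.map_source hz₁
  have hθ : ContDiffAt ℝ 1 (fun w => e₁ (e₀.symm w)) (Φ 0) := by
    rw [h0]
    exact contDiffAt_coordChange x₀ x₁ ht₀ (by rwa [e₀.left_inv hz₀])
  have hθ' : ContDiffAt ℝ 1 (fun w => e₀ (e₁.symm w)) (e₁ (e₀.symm (Φ 0))) := by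
    rw [h0, e₀.left_inv hz₀]
    exact contDiffAt_coordChange x₁ x₀ ht₁ (by rwa [e₁.left_inv hz₁])
  have hev : ∀ᶠ w in 𝓝 (Φ 0), w ∈ e₀.target ∧ e₀.symm w ∈ e₁.source := by
    rw [h0]
    refine Filter.Eventually.and (e₀.open_target.mem_nhds ht₀) ?_
    have := e₀.continuousAt_symm ht₀
    refine this.preimage_mem_nhds (e₁.open_source.mem_nhds ?_)
    rwa [e₀.left_inv hz₀]
  refine ⟨fun τ => e₁ (e₀.symm (Φ τ)), hθ.comp 0 hΦ, ?_, by simp only [h0, e₀.left_inv hz₀], ?_⟩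
  · have h1 := fderiv_comp (x := (0 : EuclideanSpace ℝ (Fin k))) (g := fun w => e₁ (e₀.symm w))
      (f := Φ) (hθ.differentiableAt one_ne_zero) (hΦ.differentiableAt one_ne_zero)
    have h2 := fderiv_comp (x := Φ 0) (g := fun w => e₀ (e₁.symm w))
      (f := fun w => e₁ (e₀.symm w)) (hθ'.differentiableAt one_ne_zero)
      (hθ.differentiableAt one_ne_zero)
    have h3 : (fun w => e₀ (e₁.symm w)) ∘ (fun w => e₁ (e₀.symm w)) =ᶠ[𝓝 (Φ 0)] id := by
      filter_upwards [hev] with w hw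
      simp [e₁.left_inv hw.2, e₀.right_inv hw.1]
    rw [h3.fderiv_eq, fderiv_id] at h2
    have h4 : Function.Injective (fderiv ℝ (fun w => e₁ (e₀.symm w)) (Φ 0)) := by
      refine Function.LeftInverse.injective
        (g := fderiv ℝ (fun w => e₀ (e₁.symm w)) (e₁ (e₀.symm (Φ 0)))) fun x => ?_
      have := DFunLike.congr_fun h2 x
      simpa using this.symm
    change Function.Injective (fderiv ℝ ((fun w => e₁ (e₀.symm w)) ∘ Φ) 0)
    rw [h1, ContinuousLinearMap.coe_comp]
    exact h4.comp hi
  · filter_upwards [hA, hΦ.continuousAt.eventually hev] with τ h1 h2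
    rwa [e₁.left_inv h2.2]

-- A linear isomorphism and a translation recentre the immersion at the origin of the model space,
-- so discs may be parametrized by any `k`-dimensional space.
omit [FiniteDimensional ℝ E] [IsManifold 𝓘(ℝ, E) ∞ M] in
theorem mem_discPoints_of_immersion {P : Type*} [NormedAddCommGroup P] [NormedSpace ℝ P]
    [FiniteDimensional ℝ P] {A : Set M} {k : ℕ} (hk : Module.finrank ℝ P = k) {x₀ : M}
    {Φ : P → E} {p : P} (hΦ : ContDiffAt ℝ 1 Φ p) (hi : Function.Injective (fderiv ℝ Φ p))
    (hp : Φ p ∈ (chartAt E x₀).target) (hA : ∀ᶠ q in 𝓝 p, (chartAt E x₀).symm (Φ q) ∈ A) :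
    (chartAt E x₀).symm (Φ p) ∈ discPoints E A k := by
  let l : EuclideanSpace ℝ (Fin k) ≃L[ℝ] P := ContinuousLinearEquiv.ofFinrankEq (by simp [hk])
  have hl : ContDiff ℝ 1 (fun τ => l τ + p) := l.contDiff.add contDiff_const
  have hl0 : l 0 + p = p := by simp
  refine ⟨x₀, (chartAt E x₀).map_target hp, fun τ => Φ (l τ + p), ?_, ?_, ?_, ?_⟩
  · exact ContDiffAt.comp (0 : EuclideanSpace ℝ (Fin k)) (by rwa [hl0]) hl.contDiffAt
  · have h1 : HasFDerivAt (fun τ => l τ + p) (l : EuclideanSpace ℝ (Fin k) →L[ℝ] P) 0 :=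
      l.hasFDerivAt.add_const p
    have h2 : HasFDerivAt Φ (fderiv ℝ Φ p) (l 0 + p) := by
      rw [hl0]; exact (hΦ.differentiableAt one_ne_zero).hasFDerivAt
    have h3 := h2.comp (0 : EuclideanSpace ℝ (Fin k)) h1
    have h4 : fderiv ℝ (fun τ => Φ (l τ + p)) 0 = _ := h3.fderiv
    rw [h4, ContinuousLinearMap.coe_comp]
    exact hi.comp l.injective
  · simp [(chartAt E x₀).right_inv hp]
  · have : Tendsto (fun τ => l τ + p) (𝓝 0) (𝓝 p) := by
      have := hl.continuous.tendsto 0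
      rwa [hl0] at this
    exact this.eventually hA

end AdmissibleClass

/-! ### Disc points are preserved backward along trajectories. -/

section BackwardInvariance

variable {E : Type*} [NormedAddCommGroup E] [NormedSpace ℝ E] [FiniteDimensional ℝ E]
    {M : Type*} [TopologicalSpace M] [ChartedSpace E M] [IsManifold 𝓘(ℝ, E) ∞ M] {m : ℕ}
    {F : (x : M) → EuclideanSpace ℝ (Fin m) → TangentSpace 𝓘(ℝ, E) x}
    {U V : Set (EuclideanSpace ℝ (Fin m))} {𝒰 : ℝ → Set (ℝ → EuclideanSpace ℝ (Fin m))}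

/-- Over a short time the backward flow for the same control is `C¹` with injective differential, so
it moves a disc through `γ t` to an immersed disc through `γ s`. Each point of the new disc near `γ
s` is steered into `A` by the restricted control, hence belongs to `A`. -/
theorem exists_forall_mem_discPoints_of_close (hF : SmoothOn F V) (h𝒰 : IsAdmissibleClass U V 𝒰)
    {A : Set M} (hA : ∀ x, ∀ y ∈ A, y ∈ attainableSet F 𝒰 x → x ∈ A) {k : ℕ} {T : ℝ}
    {u : ℝ → EuclideanSpace ℝ (Fin m)} (hu : u ∈ 𝒰 T) {γ : ℝ → M} (hγ : IsTrajectory F T u γ)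
    {t₀ : ℝ} (ht₀ : t₀ ∈ Icc 0 T) :
    ∃ δ > 0, ∀ s t, 0 ≤ s → s ≤ t → t ≤ T → |s - t₀| < δ → |t - t₀| < δ →
      γ t ∈ discPoints E A k → γ s ∈ discPoints E A k := by
  have : CompleteSpace E := FiniteDimensional.complete ℝ E
  set x₀ := γ t₀
  set e := chartAt E x₀ with he
  obtain ⟨K, hK, hKV, huK⟩ := h𝒰.exists_compact hu
  have : CompactSpace K := isCompact_iff_compactSpace.1 hK
  obtain ⟨ρ, hρ, hρO, g, g', L, C, hL, hC0, hg, hgC, hgf⟩ := exists_isLipschitzFamily e.open_target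
    (contDiffOn_chartField hF x₀) hK hKV (e.map_source (mem_chart_source E x₀))
  have hN : e.source ∩ e ⁻¹' Metric.ball (e x₀) (ρ / 2) ∈ 𝓝 x₀ :=
    inter_mem (e.open_source.mem_nhds (mem_chart_source E x₀))
      ((e.continuousAt (mem_chart_source E x₀)).preimage_mem_nhds
        (Metric.ball_mem_nhds _ (by positivity)))
  obtain ⟨δ, hδ, hδN⟩ := Metric.mem_nhdsWithin_iff.1 (hγ.1.1 t₀ ht₀ hN)
  -- Two times this close to `t₀` differ by less than `1 / (4 (L + 1))`, as the backward flow
  -- requires, and `δ` keeps the curve in the ball of radius `ρ / 2`.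
  refine ⟨min δ (1 / (8 * (L + 1))), by positivity, fun s t hs hst htT hsδ htδ ht => ?_⟩
  rcases hst.eq_or_lt with rfl | hlt
  · exact ht
  have hsub : Icc s t ⊆ Icc 0 T := Icc_subset_Icc hs htT
  have hγN : ∀ r ∈ Icc s t, γ r ∈ e.source ∧ e (γ r) ∈ Metric.ball (e x₀) (ρ / 2) := by
    intro r hr
    refine hδN ⟨?_, hsub hr⟩
    rw [Metric.mem_ball, Real.dist_eq, abs_lt]
    have h1 := (abs_lt.1 hsδ).1
    have h2 := (abs_lt.1 htδ).2
    have h3 := min_le_left δ (1 / (8 * (L + 1)))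
    constructor <;> linarith [hr.1, hr.2]
  have hLst : L * (t - s) ≤ 1 / 4 := by
    have h1 := (abs_lt.1 hsδ).1
    have h2 := (abs_lt.1 htδ).2
    have h3 := min_le_right δ (1 / (8 * (L + 1)))
    have h4 : t - s ≤ 2 * (1 / (8 * (L + 1))) := by linarith
    calc L * (t - s) ≤ (L + 1) * (2 * (1 / (8 * (L + 1)))) := by gcongr; linarith
      _ = 1 / 4 := by field_simp; norm_num
  have huK' := ae_restrict_of_ae_restrict_of_subset hsub huK
  -- An interval of positive length has positive measure, so the control takes a value in `K`.
  have hKne : K.Nonempty := by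
    by_contra hne
    rw [not_nonempty_iff_eq_empty] at hne
    simp only [hne, mem_empty_iff_false] at huK'
    have h0 : volume.restrict (Icc s t) = 0 := ae_eq_bot.1 (eventually_false_iff_eq_bot.1 huK')
    rw [Measure.restrict_eq_zero, Real.volume_Icc, ENNReal.ofReal_eq_zero] at h0
    linarith
  obtain ⟨u', hu'm, hu'⟩ := exists_stronglyMeasurable_subtype hK hKne
    ((h𝒰.aestronglyMeasurable hu).mono_measure (Measure.restrict_mono_set volume hsub)) huK'
  obtain ⟨Γ, hΓc, hΓ, hΓd, hΓi, hΓl, hΓu⟩ := exists_backward_flow hst hg hu'm hL hLst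
  obtain ⟨hac, hder⟩ := hγ.chart_curve x₀ hs hst htT (fun r hr => (hγN r hr).1)
  set c : ℝ → E := fun r => e (γ r) with hc
  have hs' : s ∈ Icc s t := ⟨le_rfl, hst⟩
  have ht' : t ∈ Icc s t := ⟨hst, le_rfl⟩
  have hcc : ContinuousOn c (Icc s t) := by
    have := hac.continuousOn
    rwa [uIcc_of_le hst] at this
  have hder' : ∀ᵐ r ∂(volume.restrict (Icc s t)), HasDerivAt c (g (c r) (u' r)) r := by
    filter_upwards [hder, hu', ae_restrict_mem measurableSet_Icc] with r h1 h2 h3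
    rw [hgf _ (Metric.ball_subset_ball (by linarith) (hγN r h3).2), h2]
    exact h1
  have hcΓ := hΓu c hcc fun r hr => eq_add_integral_of_ae_hasDerivAt hst hac hder'
    (Eventually.of_forall fun r => hgC _ _) ht' hr
  obtain ⟨Φ, hΦ, hΦi, hΦ0, hΦA⟩ := exists_disc_of_mem_discPoints ht (hγN t ht').1
  have hΦ0' : Φ 0 = c t := hΦ0
  have hΨ : ContDiffAt ℝ 1 (fun τ => Γ (Φ τ) s) 0 := hΓd.contDiffAt.comp _ hΦ
  have hΨi : Function.Injective (fderiv ℝ (fun τ => Γ (Φ τ) s) 0) := by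
    have h1 := fderiv_comp (x := (0 : EuclideanSpace ℝ (Fin k))) (g := fun x => Γ x s) (f := Φ)
      (hΓd.contDiffAt.differentiableAt one_ne_zero) (hΦ.differentiableAt one_ne_zero)
    change Function.Injective (fderiv ℝ ((fun x => Γ x s) ∘ Φ) 0)
    rw [h1, ContinuousLinearMap.coe_comp]
    exact (hΓi _).comp hΦi
  have hΨ0 : Γ (Φ 0) s = e (γ s) := by rw [hΦ0']; exact (hcΓ hs').symm
  have hres := mem_discPoints_of_immersion (A := A) (k := k) (by simp) (x₀ := x₀) hΨ hΨi
    (by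
      rw [hΨ0]; exact e.map_source (hγN s hs').1) (by
      -- By the `2`-Lipschitz dependence on the final point, the flow curves stay within `ρ / 2` of
      -- `c`, hence in the ball of radius `ρ` where the cutoff field is the true one.
      have hnear : ∀ᶠ τ in 𝓝 0, ‖Φ τ - Φ 0‖ < ρ / 4 := by
        have := hΦ.continuousAt (Metric.ball_mem_nhds _ (by positivity : 0 < ρ / 4))
        filter_upwards [this] with τ hτ
        rw [← dist_eq_norm]; exact hτ
      filter_upwards [hΦA, hnear] with τ h1 h2
      have hmaps : ∀ r ∈ Icc s t, Γ (Φ τ) r ∈ Metric.ball (e x₀) ρ := by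
        intro r hr
        have h3 := hΓl (Φ 0) (Φ τ) r hr
        have h4 : Γ (Φ 0) r = c r := by rw [hΦ0']; exact (hcΓ hr).symm
        have h5 : dist (c r) (e x₀) < ρ / 2 := (hγN r hr).2
        rw [h4, ← dist_eq_norm] at h3
        rw [Metric.mem_ball]
        linarith [dist_triangle (Γ (Φ τ) r) (c r) (e x₀)]
      have hΓt : Γ (Φ τ) t = Φ τ := by simpa using hΓ (Φ τ) t ht'
      refine hA _ _ h1 ?_
      have h6 := mem_attainableSet_of_integral_curve (F := F) (𝒰 := 𝒰) (c := Γ (Φ τ))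
        (w := fun r => g (Γ (Φ τ) r) (u' r)) (C := C) hst x₀ (h𝒰.restrict hu hs hst htT)
        (intervalIntegrable_of_continuous_curve hg.continuous hu'm (hΓc _) s t)
        (fun r => hgC _ _) (fun r hr => by rw [hΓt]; exact hΓ _ r hr)
        (fun r hr => hρO (hmaps r hr)) (by
          filter_upwards [hu', ae_restrict_mem measurableSet_Icc] with r h2 h3
          rw [hgf _ (hmaps r h3), h2])
      rwa [hΓt] at h6)
  change e.symm (Γ (Φ 0) s) ∈ _ at hres
  rwa [hΨ0, e.left_inv (hγN s hs').1] at hres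

/-- The set of points lying on `k`-dimensional discs of a backward invariant set is backward
invariant. -/
theorem mem_discPoints_of_mem_attainableSet (hF : SmoothOn F V) (h𝒰 : IsAdmissibleClass U V 𝒰)
    {A : Set M} (hA : ∀ x, ∀ y ∈ A, y ∈ attainableSet F 𝒰 x → x ∈ A) {k : ℕ} {x y : M}
    (hy : y ∈ discPoints E A k) (hxy : y ∈ attainableSet F 𝒰 x) : x ∈ discPoints E A k := by
  obtain ⟨T, hT, u, hu, γ, hγ, rfl, rfl⟩ := hxy
  choose! δ hδ H using fun t₀ (ht₀ : t₀ ∈ Icc 0 T) =>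
    exists_forall_mem_discPoints_of_close hF h𝒰 hA (k := k) hu hγ ht₀
  let N : Icc 0 T → Set (Icc 0 T) := fun t₀ => {t | |(t : ℝ) - t₀| < δ t₀}
  have hNo : ∀ t₀, IsOpen (N t₀) := fun t₀ =>
    isOpen_lt (by fun_prop) continuous_const
  have hNc : (univ : Set (Icc 0 T)) ⊆ ⋃ t₀, N t₀ := fun t _ => by
    rw [mem_iUnion]
    refine ⟨t, ?_⟩
    simpa [N] using hδ t t.2
  -- By compactness, finitely many of the short backward steps lead from `T` to `0`.
  obtain ⟨p, hp0, hpm, ⟨n, hpn⟩, hpN⟩ := exists_monotone_Icc_subset_open_cover_Icc hT hNo hNc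
  have step : ∀ i, γ (p (i + 1)) ∈ discPoints E A k → γ (p i) ∈ discPoints E A k := by
    intro i hi
    obtain ⟨t₀, ht₀⟩ := hpN i
    have hle : p i ≤ p (i + 1) := hpm (Nat.le_succ i)
    exact H t₀ t₀.2 (p i) (p (i + 1)) (p i).2.1 hle (p (i + 1)).2.2
      (ht₀ ⟨le_rfl, hle⟩) (ht₀ ⟨hle, le_rfl⟩) hi
  have hall : ∀ j, γ (p j) ∈ discPoints E A k → γ (p 0) ∈ discPoints E A k := by
    intro j
    induction j with
    | zero => exact id
    | succ j ih => exact fun h => ih (step j h)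
  have hn : (p n : ℝ) = T := by
    have := hpn n le_rfl
    rw [this]
  have := hall n (by rwa [hn])
  rwa [hp0] at this

end BackwardInvariance

/-! ### Backward flow of a frozen field, jointly `C¹` in point and time. -/

section RescaledFlow

variable {E K : Type*} [NormedAddCommGroup E] [NormedSpace ℝ E] [TopologicalSpace K]
  {g : E → K → E} {g' : E → K → E →L[ℝ] E} {L C : ℝ}

/-- Adding the time scale `s`, through the bounded factor `sin s`, as a state variable. -/
theorem IsLipschitzFamily.rescale (hg : IsLipschitzFamily g g' L) (hC : ∀ x k, ‖g x k‖ ≤ C) :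
    IsLipschitzFamily (fun (p : E × ℝ) k => (Real.sin p.2 • g p.1 k, (0 : ℝ)))
      (fun p k => (ContinuousLinearMap.inl ℝ E ℝ).comp
        ((Real.sin p.2 • g' p.1 k).comp (ContinuousLinearMap.fst ℝ E ℝ)
        + (Real.cos p.2 • ContinuousLinearMap.snd ℝ E ℝ).smulRight (g p.1 k))) (L + C) where
  continuous := by
    have h := hg.continuous.comp (continuous_fst.fst.prodMk continuous_snd :
      Continuous fun q : (E × ℝ) × K => (q.1.1, q.2))
    exact ((Real.continuous_sin.comp continuous_fst.snd).smul h).prodMk continuous_const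
  continuous' := by
    have h := hg.continuous.comp (continuous_fst.fst.prodMk continuous_snd :
      Continuous fun q : (E × ℝ) × K => (q.1.1, q.2))
    have h' := hg.continuous'.comp (continuous_fst.fst.prodMk continuous_snd :
      Continuous fun q : (E × ℝ) × K => (q.1.1, q.2))
    have h1 : Continuous fun q : (E × ℝ) × K =>
        (Real.sin q.1.2 • g' q.1.1 q.2).comp (ContinuousLinearMap.fst ℝ E ℝ) :=
      ((Real.continuous_sin.comp continuous_fst.snd).smul h').clm_comp continuous_const
    have h2 : Continuous fun q : (E × ℝ) × K =>
        (Real.cos q.1.2 • ContinuousLinearMap.snd ℝ E ℝ).smulRight (g q.1.1 q.2) :=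
      (ContinuousLinearMap.smulRightL ℝ (E × ℝ) E).continuous₂.comp
        (((Real.continuous_cos.comp continuous_fst.snd).smul continuous_const).prodMk h)
    exact continuous_const.clm_comp (h1.add h2)
  hasFDerivAt p k := by
    have h1 : HasFDerivAt (fun q : E × ℝ => g q.1 k)
        ((g' p.1 k).comp (ContinuousLinearMap.fst ℝ E ℝ)) p :=
      (hg.hasFDerivAt p.1 k).comp p hasFDerivAt_fst
    have h2 : HasFDerivAt (fun q : E × ℝ => Real.sin q.2)
        (Real.cos p.2 • ContinuousLinearMap.snd ℝ E ℝ) p :=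
      (Real.hasDerivAt_sin p.2).comp_hasFDerivAt p hasFDerivAt_snd
    exact (ContinuousLinearMap.inl ℝ E ℝ).hasFDerivAt.comp p (h2.smul h1)
  norm_le p k := by
    have hL : 0 ≤ L := (norm_nonneg _).trans (hg.norm_le p.1 k)
    have hC0 : 0 ≤ C := (norm_nonneg _).trans (hC p.1 k)
    refine ContinuousLinearMap.opNorm_le_bound _ (by positivity) fun q => ?_
    have h1 : ‖Real.sin p.2 • g' p.1 k q.1‖ ≤ L * ‖q‖ := by
      rw [norm_smul]
      have h3 : ‖g' p.1 k q.1‖ ≤ L * ‖q‖ := ((g' p.1 k).le_opNorm _).trans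
        (mul_le_mul (hg.norm_le _ _) (norm_fst_le q) (norm_nonneg _) hL)
      calc _ ≤ 1 * ‖g' p.1 k q.1‖ := by gcongr; exact Real.abs_sin_le_one _
        _ ≤ _ := by rw [one_mul]; exact h3
    have h2 : ‖(Real.cos p.2 * q.2) • g p.1 k‖ ≤ C * ‖q‖ := by
      rw [norm_smul, norm_mul]
      calc _ ≤ 1 * ‖q‖ * C := by
            gcongr
            · exact Real.abs_cos_le_one _
            · exact norm_snd_le q
            · exact hC _ _
        _ = _ := by ring
    simp only [add_apply, ContinuousLinearMap.comp_apply, ContinuousLinearMap.inl_apply,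
      ContinuousLinearMap.smulRight_apply, smul_apply, smul_eq_mul,
      ContinuousLinearMap.coe_fst', ContinuousLinearMap.coe_snd']
    rw [Prod.norm_def]
    simp only [norm_zero]
    rw [max_eq_left (norm_nonneg _)]
    have h4 := norm_add_le (Real.sin p.2 • g' p.1 k q.1) ((Real.cos p.2 * q.2) • g p.1 k)
    linarith [h4, h1, h2]

variable [CompleteSpace E] [CompactSpace K]

/-- The backward flow of an autonomous field, at times proportional to `sin s`, as a `C¹` map of
the pair of the final point and `s`. -/
theorem exists_rescaled_flow (hg : IsLipschitzFamily g g' L) (hL : 0 ≤ L) (hC : ∀ x k, ‖g x k‖ ≤ C)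
    (k : K) :
    ∃ η > 0, ∃ Γ : E × ℝ → ℝ → E, (∀ p, Continuous (Γ p)) ∧
      (∀ p, ∀ t ∈ Icc 0 η, Γ p t = p.1 + ∫ r in η..t, Real.sin p.2 • g (Γ p r) k) ∧
      ContDiff ℝ 1 (fun p => Γ p 0) ∧
      (∀ p x, ∀ t ∈ Icc 0 η, ‖Γ p t - x‖ ≤ 2 * ‖p - (x, 0)‖) ∧
      ∀ x ξ σ, fderiv ℝ (fun p => Γ p 0) (x, 0) (ξ, σ) = ξ - (σ * η) • g x k := by
  rcases isEmpty_or_nonempty E with hE | ⟨⟨x₀⟩⟩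
  · exact (hE.false 0).elim
  have hC0 : 0 ≤ C := (norm_nonneg _).trans (hC x₀ k)
  -- Chosen so that `(L + C) η ≤ 1/4`, where `L + C` bounds the derivative of the rescaled field.
  set η : ℝ := 1 / (4 * (L + C + 1)) with hη
  have hη0 : 0 < η := by positivity
  have hlt : (L + C) * (η - 0) ≤ 1 / 4 := by
    rw [hη, sub_zero, mul_one_div, div_le_div_iff₀ (by positivity) (by norm_num)]
    linarith
  have h0 : (0 : ℝ) ∈ Icc 0 η := ⟨le_rfl, hη0.le⟩
  -- With `s` as a state variable of zero velocity, `C¹` dependence on the final point includes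
  -- dependence on the duration. The factor `sin s` is bounded, positive on `(0, π)`, and vanishes
  -- to first order at `0` with slope `1`.
  have hGF := hg.rescale hC
  obtain ⟨Γ, hΓc, hΓ, hΓd, -, hΓl, -⟩ := exists_backward_flow hη0.le hGF
    (stronglyMeasurable_const (b := k)) (by positivity) hlt
  have hint : ∀ p s t, IntervalIntegrable (fun r => (Real.sin (Γ p r).2 • g (Γ p r).1 k, (0 : ℝ)))
      volume s t := fun p s t => intervalIntegrable_of_continuous_curve
        (G := fun (p : E × ℝ) k => (Real.sin p.2 • g p.1 k, (0 : ℝ))) hGF.continuous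
        (stronglyMeasurable_const (b := k)) (hΓc p) s t
  have hsnd : ∀ p, ∀ t ∈ Icc 0 η, (Γ p t).2 = p.2 := by
    intro p t ht
    rw [hΓ p t ht]
    have := (ContinuousLinearMap.snd ℝ E ℝ).intervalIntegral_comp_comm (hint p η t)
    simp only [ContinuousLinearMap.coe_snd', intervalIntegral.integral_zero] at this
    rw [Prod.snd_add, ← this, add_zero]
  have hfst : ∀ p, ∀ t ∈ Icc 0 η, (Γ p t).1
      = p.1 + ∫ r in η..t, Real.sin p.2 • g (Γ p r).1 k := by
    intro p t ht
    nth_rw 1 [hΓ p t ht]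
    have := (ContinuousLinearMap.fst ℝ E ℝ).intervalIntegral_comp_comm (hint p η t)
    simp only [ContinuousLinearMap.coe_fst'] at this
    rw [Prod.fst_add, ← this]
    congr 1
    refine intervalIntegral.integral_congr fun r hr => ?_
    rw [uIcc_of_ge ht.2] at hr
    simp only [hsnd p r ⟨ht.1.trans hr.1, hr.2⟩]
  have hz : ∀ x, ∀ t ∈ Icc 0 η, (Γ (x, 0) t).1 = x := by
    intro x t ht
    rw [hfst _ t ht]; simp
  have hd : ContDiff ℝ 1 (fun p => (Γ p 0).1) := contDiff_fst.comp hΓd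
  refine ⟨η, hη0, fun p t => (Γ p t).1, fun p => continuous_fst.comp (hΓc p), hfst, hd, ?_, ?_⟩
  · intro p x t ht
    have h1 := hΓl (x, 0) p t ht
    have h2 : Γ (x, 0) t = (x, 0) := Prod.ext (hz x t ht) (hsnd _ t ht)
    rw [h2] at h1
    exact (norm_fst_le (Γ p t - (x, 0))).trans h1
  · intro x ξ σ
    have hD := (hd.differentiable one_ne_zero (x, 0)).hasFDerivAt
    set D := fderiv ℝ (fun p => (Γ p 0).1) (x, 0)
    have e1 : D (ξ, 0) = ξ := by
      have h1 := HasFDerivAt.comp (f := fun y : E => (y, (0 : ℝ))) x hD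
        (hasFDerivAt_prodMk_left x (0 : ℝ))
      have h2 : ((fun p => (Γ p 0).1) ∘ fun y => (y, (0 : ℝ))) = id := by
        funext y; exact hz y 0 h0
      rw [h2] at h1
      have h3 := h1.unique (hasFDerivAt_id x)
      exact DFunLike.congr_fun h3 ξ
    -- Write the flow as `x + sin s • J s` with `J 0 = -(η • g x k)`. As `J` varies by `O(|s|)`,
    -- replacing `J s` by `J 0` costs only `O(s²)`.
    have e2 : D (0, 1) = -(η • g x k) := by
      have h1 := (HasFDerivAt.comp (f := fun s : ℝ => (x, s)) (0 : ℝ) hD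
        (hasFDerivAt_prodMk_right x (0 : ℝ))).hasDerivAt
      let J : ℝ → E := fun s => ∫ r in η..0, g (Γ (x, s) r).1 k
      have hJi : ∀ s, IntervalIntegrable (fun r => g (Γ (x, s) r).1 k) volume η 0 := fun s =>
        intervalIntegrable_of_continuous_curve hg.continuous
          (stronglyMeasurable_const (b := k)) (continuous_fst.comp (hΓc (x, s))) _ _
      have hJ0 : J 0 = -(η • g x k) := by
        have : J 0 = ∫ r in η..0, g x k := intervalIntegral.integral_congr fun r hr => by
          rw [uIcc_of_ge hη0.le] at hr
          simp only [hz x r hr]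
        rw [this, intervalIntegral.integral_const]; simp
      have hJl : ∀ s, ‖J s - J 0‖ ≤ L * (2 * |s|) * η := by
        intro s
        rw [← intervalIntegral.integral_sub (hJi s) (hJi 0)]
        refine (intervalIntegral.norm_integral_le_of_norm_le_const (C := L * (2 * |s|))
          fun r hr => ?_).trans (by simp [abs_of_pos hη0])
        rw [uIoc_of_ge hη0.le] at hr
        refine (hg.norm_sub_le _ _ _).trans ?_
        gcongr
        refine (norm_fst_le (Γ (x, s) r - Γ (x, 0) r)).trans
          ((hΓl (x, 0) (x, s) r ⟨hr.1.le, hr.2⟩).trans ?_)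
        simp [Prod.norm_def]
      have h2 : (fun s => (Γ (x, s) 0).1)
          = fun s => (x + Real.sin s • J 0) + Real.sin s • (J s - J 0) := by
        funext s
        rw [hfst _ 0 h0, intervalIntegral.integral_smul, add_assoc, ← smul_add]
        simp [J]
      have h3 : HasDerivAt (fun s => Real.sin s • (J s - J 0)) 0 0 := by
        have : HasFDerivAt (fun s => Real.sin s • (J s - J 0)) (0 : ℝ →L[ℝ] E) 0 := by
          refine Asymptotics.IsBigO.hasFDerivAt (n := 2) ?_ (by norm_num)
          refine Asymptotics.IsBigO.of_bound (L * 2 * η) (Eventually.of_forall fun s => ?_)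
          rw [norm_smul, sub_zero, norm_pow, norm_norm, Real.norm_eq_abs, Real.norm_eq_abs]
          calc |Real.sin s| * ‖J s - J 0‖ ≤ |s| * (L * (2 * |s|) * η) :=
                mul_le_mul Real.abs_sin_le_abs (hJl s) (norm_nonneg _) (abs_nonneg _)
            _ = _ := by ring
        simpa using this.hasDerivAt
      have h4 : HasDerivAt (fun s => x + Real.sin s • J 0) (J 0) 0 := by
        have := ((Real.hasDerivAt_sin 0).smul_const (J 0)).const_add x
        simpa using this
      have h5 := h4.fun_add h3
      rw [add_zero] at h5
      have h6 : HasDerivAt (fun s => (Γ (x, s) 0).1) (J 0) 0 := by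
        rw [h2]; exact h5
      have h7 := h1.unique h6
      rw [← hJ0, ← h7]; simp
    have h3 : ((ξ, σ) : E × ℝ) = (ξ, 0) + σ • ((0 : E), (1 : ℝ)) := by simp
    rw [h3, map_add, map_smul, e1, e2, smul_neg, smul_smul, sub_eq_add_neg]

end RescaledFlow

/-! ### Immersed discs as graphs. -/

section Graph

/-- An immersed disc is locally a graph over its tangent space. -/
theorem exists_graph {E P : Type*} [NormedAddCommGroup E] [NormedSpace ℝ E]
    [FiniteDimensional ℝ E] [NormedAddCommGroup P] [NormedSpace ℝ P] [FiniteDimensional ℝ P]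
    {Φ : P → E} {p : P} (hΦ : ContDiffAt ℝ 1 Φ p) (hi : Function.Injective (fderiv ℝ Φ p)) :
    ∃ (π : E →L[ℝ] P) (σ : P → P), ContDiffAt ℝ 1 σ (π (Φ p)) ∧ σ (π (Φ p)) = p ∧
      ∀ᶠ q in 𝓝 (π (Φ p)), π (Φ (σ q)) = q := by
  have : CompleteSpace P := FiniteDimensional.complete ℝ P
  obtain ⟨l, hl⟩ := LinearMap.exists_leftInverse_of_injective
    (fderiv ℝ Φ p : P →ₗ[ℝ] E) (LinearMap.ker_eq_bot.2 hi)
  -- As `π` is a left inverse of the differential, `π ∘ Φ` has derivative the identity at `p`; `σ`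
  -- is its local inverse.
  let π : E →L[ℝ] P := LinearMap.toContinuousLinearMap l
  have hf : ContDiffAt ℝ 1 (fun q => π (Φ q)) p := π.contDiff.contDiffAt.comp p hΦ
  have hf' : HasFDerivAt (fun q => π (Φ q))
      ((ContinuousLinearEquiv.refl ℝ P : P ≃L[ℝ] P) : P →L[ℝ] P) p := by
    have h1 : HasFDerivAt (fun q => π (Φ q)) (π.comp (fderiv ℝ Φ p)) p :=
      π.hasFDerivAt.comp p (hΦ.differentiableAt one_ne_zero).hasFDerivAt
    refine h1.congr_fderiv ?_
    ext x
    exact DFunLike.congr_fun hl x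
  refine ⟨π, hf.localInverse hf' one_ne_zero, hf.to_localInverse hf' one_ne_zero,
    hf.localInverse_apply_image hf' one_ne_zero, ?_⟩
  exact (hf.hasStrictFDerivAt' hf' one_ne_zero).eventually_right_inverse

end Graph

/-! ### Maximality of the dimension forces tangency. -/

section Tangency

variable {E : Type*} [NormedAddCommGroup E] [NormedSpace ℝ E] [FiniteDimensional ℝ E]
    {M : Type*} [TopologicalSpace M] [ChartedSpace E M] [IsManifold 𝓘(ℝ, E) ∞ M] {m : ℕ}
    {F : (x : M) → EuclideanSpace ℝ (Fin m) → TangentSpace 𝓘(ℝ, E) x}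
    {U V : Set (EuclideanSpace ℝ (Fin m))} {𝒰 : ℝ → Set (ℝ → EuclideanSpace ℝ (Fin m))}
    {A : Set M} {k : ℕ}
    {P : Type*} [NormedAddCommGroup P] [NormedSpace ℝ P] [FiniteDimensional ℝ P]

/-- If a set is stable under backward trajectories and contains no immersed disc of dimension
`k + 1`, then the controlled fields are tangent to the immersed discs of dimension `k` in it. -/
theorem chartField_mem_range (hF : SmoothOn F V) (h𝒰 : IsAdmissibleClass U V 𝒰)
    (hA : ∀ x, ∀ y ∈ A, y ∈ attainableSet F 𝒰 x → x ∈ A) (hmax : discPoints E A (k + 1) = ∅)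
    (hk : Module.finrank ℝ P = k) {x₀ : M} {Φ : P → E} {p : P} (hΦ : ContDiffAt ℝ 1 Φ p)
    (hi : Function.Injective (fderiv ℝ Φ p)) (hp : Φ p ∈ (chartAt E x₀).target)
    (hΦA : ∀ᶠ q in 𝓝 p, (chartAt E x₀).symm (Φ q) ∈ A) {v : EuclideanSpace ℝ (Fin m)}
    (hv : v ∈ U) : chartField F x₀ (Φ p) v ∈ range (fderiv ℝ Φ p) := by
  by_contra hX
  have : CompleteSpace E := FiniteDimensional.complete ℝ E
  have : CompactSpace ({v} : Set (EuclideanSpace ℝ (Fin m))) :=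
    isCompact_iff_compactSpace.1 isCompact_singleton
  obtain ⟨ρ, hρ, hρO, g, g', L, C, hL, -, hg, hC, hgf⟩ :=
    exists_isLipschitzFamily (chartAt E x₀).open_target (contDiffOn_chartField hF x₀)
      (isCompact_singleton (x := v)) (singleton_subset_iff.2 (h𝒰.subset hv)) hp
  let v₀ : ({v} : Set (EuclideanSpace ℝ (Fin m))) := ⟨v, rfl⟩
  obtain ⟨η, hη, Γ, hΓc, hΓ, hΓd, hΓl, hΓ'⟩ := exists_rescaled_flow hg hL hC v₀
  -- The disc swept out by flowing `Φ` backward for the time `η sin s`. At `(p, 0)` its differential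
  -- is `(ξ, σ) ↦ dΦ ξ - σ η X`, injective because `X` is transverse to `Φ`.
  let Ψ : P × ℝ → E := fun q => Γ (Φ q.1, q.2) 0
  have hfst : Tendsto (Prod.fst : P × ℝ → P) (𝓝 (p, 0)) (𝓝 p) := continuous_fst.tendsto (p, (0 : ℝ))
  have hpair : ∀ q : P × ℝ, ContDiffAt ℝ 1 Φ q.1 →
      ContDiffAt ℝ 1 (fun q : P × ℝ => (Φ q.1, q.2)) q := fun q hq =>
    (ContDiffAt.comp (f := Prod.fst) q hq contDiffAt_fst).prodMk contDiffAt_snd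
  have hΨ : ∀ q : P × ℝ, ContDiffAt ℝ 1 Φ q.1 → ContDiffAt ℝ 1 Ψ q := fun q hq =>
    ContDiffAt.comp (g := fun z => Γ z 0) q hΓd.contDiffAt (hpair q hq)
  have hΨi : Function.Injective (fderiv ℝ Ψ (p, 0)) := by
    have h1 : HasFDerivAt (fun q : P × ℝ => (Φ q.1, q.2))
        (((fderiv ℝ Φ p).comp (ContinuousLinearMap.fst ℝ P ℝ)).prod
          (ContinuousLinearMap.snd ℝ P ℝ)) (p, 0) :=
      (HasFDerivAt.comp (f := Prod.fst) (p, (0 : ℝ))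
        (hΦ.differentiableAt one_ne_zero).hasFDerivAt hasFDerivAt_fst).prodMk hasFDerivAt_snd
    have h2 : HasFDerivAt Ψ _ (p, 0) := HasFDerivAt.comp (g := fun z => Γ z 0) (p, (0 : ℝ))
      (hΓd.differentiable one_ne_zero (Φ p, 0)).hasFDerivAt h1
    rw [h2.fderiv]
    refine (injective_iff_map_eq_zero _).2 ?_
    rintro ⟨ξ, σ⟩ h0
    have h3 : fderiv ℝ Φ p ξ - (σ * η) • g (Φ p) v₀ = 0 := by
      rw [← hΓ' (Φ p)]; exact h0
    rw [hgf _ (Metric.mem_ball_self hρ)] at h3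
    by_cases hσ : σ = 0
    · rw [hσ, zero_mul, zero_smul, sub_zero] at h3
      rw [hσ, (injective_iff_map_eq_zero _).1 hi ξ h3]
      rfl
    · refine (hX ⟨(σ * η)⁻¹ • ξ, ?_⟩).elim
      rw [map_smul, sub_eq_zero.1 h3, smul_smul, inv_mul_cancel₀ (by positivity), one_smul]
  have hev : ∀ᶠ q : P × ℝ in 𝓝 (p, 0), (ContDiffAt ℝ 1 Φ q.1 ∧
      Function.Injective (fderiv ℝ Ψ q)) ∧ 2 * ‖(Φ q.1, q.2) - (Φ p, 0)‖ < ρ ∧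
      (chartAt E x₀).symm (Φ q.1) ∈ A := by
    refine ((hfst.eventually (hΦ.eventually (by simp))).and ?_).and (.and ?_ (hfst.eventually hΦA))
    · have h1 : ContinuousAt (fderiv ℝ Ψ) (p, 0) :=
        ((hΨ (p, 0) hΦ).fderiv_right (m := 0) (by simp)).continuousAt
      exact h1.eventually (ContinuousLinearMap.isOpen_injective.mem_nhds hΨi)
    · have h1 : ContinuousAt (fun q : P × ℝ => 2 * ‖(Φ q.1, q.2) - (Φ p, 0)‖) (p, 0) :=
        continuousAt_const.mul ((hpair (p, 0) hΦ).continuousAt.sub continuousAt_const).norm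
      exact h1.eventually (gt_mem_nhds (by simpa using hρ))
  have hmem : ∀ q : P × ℝ, 2 * ‖(Φ q.1, q.2) - (Φ p, 0)‖ < ρ →
      ∀ t ∈ Icc 0 η, Γ (Φ q.1, q.2) t ∈ Metric.ball (Φ p) ρ := fun q hq t ht => by
    rw [mem_ball_iff_norm]
    exact (hΓl _ _ t ht).trans_lt hq
  -- For `s ∈ (0, π)` the time change `t ↦ t / sin s` gives a genuine trajectory, for the constant
  -- control `v`, from `Ψ q` to a point of `A`.
  have hΨA : ∀ q : P × ℝ, 2 * ‖(Φ q.1, q.2) - (Φ p, 0)‖ < ρ →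
      (chartAt E x₀).symm (Φ q.1) ∈ A → q.2 ∈ Ioo 0 Real.pi →
      (chartAt E x₀).symm (Ψ q) ∈ A := by
    intro q hq hqA hs
    have hsin : 0 < Real.sin q.2 := Real.sin_pos_of_pos_of_lt_pi hs.1 hs.2
    have hb : 0 ≤ Real.sin q.2 * η := by positivity
    have hdiv : ∀ t ∈ Icc 0 (Real.sin q.2 * η), t / Real.sin q.2 ∈ Icc 0 η := fun t ht =>
      ⟨div_nonneg ht.1 hsin.le, (div_le_iff₀' hsin).2 ht.2⟩
    have hbη : Real.sin q.2 * η / Real.sin q.2 = η := by field_simp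
    have hend : Γ (Φ q.1, q.2) η = Φ q.1 := by
      rw [hΓ _ η ⟨hη.le, le_rfl⟩]; simp
    have hcc : Continuous fun t => Γ (Φ q.1, q.2) (t / Real.sin q.2) :=
      (hΓc _).comp (continuous_id.div_const _)
    have key := mem_attainableSet_of_integral_curve (F := F) (𝒰 := 𝒰)
      (c := fun t => Γ (Φ q.1, q.2) (t / Real.sin q.2))
      (w := fun t => g (Γ (Φ q.1, q.2) (t / Real.sin q.2)) v₀) (C := C) hb x₀ (u := fun _ => v)
      (h𝒰.const hv (sub_nonneg.2 hb))
      ((hg.continuous.comp (hcc.prodMk continuous_const)).intervalIntegrable _ _)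
      (fun t => hC _ _)
      (fun t ht => by
        rw [hbη, hend, hΓ _ _ (hdiv t ht), intervalIntegral.integral_smul,
          intervalIntegral.integral_comp_div (fun r => g (Γ (Φ q.1, q.2) r) v₀) hsin.ne', hbη])
      (fun t ht => hρO (hmem q hq _ (hdiv t ht)))
      (by
        filter_upwards [ae_restrict_mem measurableSet_Icc] with t ht
        exact hgf _ (hmem q hq _ (hdiv t ht)) v₀)
    simp only [hbη, hend, zero_div] at key
    exact hA _ _ hqA key
  -- Membership in `A` is known only for `s > 0`, so the disc is centred at `(p, s)` with `s` small
  -- and positive; injectivity of the differential is an open condition.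
  have hs : Tendsto (fun s : ℝ => (p, s)) (𝓝[>] 0) (𝓝 (p, 0)) :=
    (Continuous.tendsto (by fun_prop) 0).mono_left nhdsWithin_le_nhds
  obtain ⟨s, hs₁, hs₂⟩ := ((hs.eventually hev.eventually_nhds).and
    (Ioo_mem_nhdsGT Real.pi_pos)).exists
  have hs₃ := hs₁.self_of_nhds
  have := mem_discPoints_of_immersion (A := A) (k := k + 1) (x₀ := x₀) (Φ := Ψ) (p := (p, s))
    (by simp [hk]) (hΨ _ hs₃.1.1) hs₃.1.2 (hρO (hmem _ hs₃.2.1 0 ⟨le_rfl, hη.le⟩)) (by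
      filter_upwards [hs₁, continuous_snd.continuousAt.preimage_mem_nhds
        (Ioo_mem_nhds hs₂.1 hs₂.2)] with q h1 h2
      exact hΨA q h1.2.1 h1.2.2 h2)
  rw [hmax] at this
  exact this

end Tangency

/-! ### Trajectories stay on discs of maximal dimension. -/

section ForwardInvariance

/-- Shrinks the graph `φ = Φ ∘ σ` to a ball with uniform derivative bound. Keeping `Q` on a
neighbourhood of every `q` makes each point of the graph, not only the centre, the centre of a disc
in `A`. -/
theorem exists_graph_ball {E P : Type*} [NormedAddCommGroup E] [NormedSpace ℝ E]
    [FiniteDimensional ℝ E] [NormedAddCommGroup P] [NormedSpace ℝ P] [FiniteDimensional ℝ P]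
    {Φ : P → E} {p : P} (hΦ : ContDiffAt ℝ 1 Φ p) (hi : Function.Injective (fderiv ℝ Φ p))
    {S Q : E → Prop} (hS : ∀ᶠ w in 𝓝 (Φ p), S w) (hQ : ∀ᶠ τ in 𝓝 p, Q (Φ τ)) :
    ∃ (π : E →L[ℝ] P) (φ : P → E) (B r : ℝ), 0 ≤ B ∧ 0 < r ∧ φ (π (Φ p)) = Φ p ∧
      ∀ q ∈ Metric.ball (π (Φ p)) r, (ContDiffAt ℝ 1 φ q ∧ (∀ ξ, π (fderiv ℝ φ q ξ) = ξ) ∧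
        ‖fderiv ℝ φ q‖ ≤ B) ∧ S (φ q) ∧ ∀ᶠ q' in 𝓝 q, Q (φ q') := by
  obtain ⟨π, σ, hσ, hσp, hπ⟩ := exists_graph hΦ hi
  set p₀ := π (Φ p)
  have hφ : ContDiffAt ℝ 1 (fun q => Φ (σ q)) p₀ :=
    ContDiffAt.comp p₀ (by rwa [hσp]) hσ
  have hc : ContinuousAt (fderiv ℝ fun q => Φ (σ q)) p₀ :=
    (hφ.fderiv_right (m := 0) (by simp)).continuousAt
  have hσt : Tendsto σ (𝓝 p₀) (𝓝 p) := by
    have := hσ.continuousAt.tendsto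
    rwa [hσp] at this
  have hφt : Tendsto (fun q => Φ (σ q)) (𝓝 p₀) (𝓝 (Φ p)) := hΦ.continuousAt.tendsto.comp hσt
  have hev : ∀ᶠ q in 𝓝 p₀, (ContDiffAt ℝ 1 (fun q => Φ (σ q)) q ∧
      (∀ᶠ q' in 𝓝 q, π (Φ (σ q')) = q') ∧
      ‖fderiv ℝ (fun q => Φ (σ q)) q‖ ≤ ‖fderiv ℝ (fun q => Φ (σ q)) p₀‖ + 1) ∧
      S (Φ (σ q)) ∧ ∀ᶠ q' in 𝓝 q, Q (Φ (σ q')) := by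
    refine ((hφ.eventually (by simp)).and (hπ.eventually_nhds.and ?_)).and
      ((hφt.eventually hS).and (hσt.eventually hQ).eventually_nhds)
    filter_upwards [hc.norm.eventually (gt_mem_nhds (lt_add_one _))] with q hq using hq.le
  obtain ⟨r, hr, hball⟩ := Metric.eventually_nhds_iff_ball.1 hev
  refine ⟨π, fun q => Φ (σ q), ‖fderiv ℝ (fun q => Φ (σ q)) p₀‖ + 1, r, by positivity, hr,
    congrArg Φ hσp, fun q hq => ?_⟩
  obtain ⟨⟨h1, h2, h3⟩, h4⟩ := hball q hq
  refine ⟨⟨h1, fun ξ => ?_, h3⟩, h4⟩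
  have h5 : HasFDerivAt (fun q => π (Φ (σ q))) (π.comp (fderiv ℝ (fun q => Φ (σ q)) q)) q :=
    π.hasFDerivAt.comp q (h1.differentiableAt one_ne_zero).hasFDerivAt
  exact DFunLike.congr_fun (h5.unique ((hasFDerivAt_id q).congr_of_eventuallyEq h2)) ξ

variable {E : Type*} [NormedAddCommGroup E] [NormedSpace ℝ E] [FiniteDimensional ℝ E]
    {M : Type*} [TopologicalSpace M] [ChartedSpace E M] [IsManifold 𝓘(ℝ, E) ∞ M] {m : ℕ}
    {F : (x : M) → EuclideanSpace ℝ (Fin m) → TangentSpace 𝓘(ℝ, E) x}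
    {U V : Set (EuclideanSpace ℝ (Fin m))} {𝒰 : ℝ → Set (ℝ → EuclideanSpace ℝ (Fin m))}
    {A : Set M} {k : ℕ}

/-- A curve driven by fields which are tangent to a graph stays in the graph. -/
theorem eqOn_graph_of_tangent {P : Type*} [NormedAddCommGroup P] [NormedSpace ℝ P] {G : Type*}
    [TopologicalSpace G] {g : E → G → E} {g' : E → G → E →L[ℝ] E} {L C B r : ℝ}
    (hg : IsLipschitzFamily g g' L) (hL : 0 ≤ L) (hC : ∀ x y, ‖g x y‖ ≤ C) (hB : 0 ≤ B)
    {π : E →L[ℝ] P} {φ : P → E} {p₀ : P}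
    (hφ : ∀ q ∈ Metric.ball p₀ r, DifferentiableAt ℝ φ q ∧ (∀ ξ, π (fderiv ℝ φ q ξ) = ξ) ∧
      ‖fderiv ℝ φ q‖ ≤ B) {a b : ℝ} (hab : a ≤ b) (hlt : (1 + B * ‖π‖) * L * (b - a) ≤ 1 / 2)
    {c : ℝ → E} (hc : AbsolutelyContinuousOnInterval c a b)
    (hcb : ∀ t ∈ Icc a b, π (c t) ∈ Metric.ball p₀ r) (hca : φ (π (c a)) = c a)
    (hd : ∀ᵐ t ∂(volume.restrict (Icc a b)), ∃ y, HasDerivAt c (g (c t) y) t ∧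
      g (φ (π (c t))) y ∈ range (fderiv ℝ φ (π (c t)))) :
    ∀ t ∈ Icc a b, φ (π (c t)) = c t := by
  have hd' : ∀ᵐ t ∂(volume.restrict (Icc a b)), HasDerivAt c (deriv c t) t := by
    filter_upwards [hd] with t ⟨y, h, _⟩
    rwa [h.deriv]
  have hdC : ∀ᵐ t ∂(volume.restrict (Icc a b)), ‖deriv c t‖ ≤ C := by
    filter_upwards [hd] with t ⟨y, h, _⟩
    rw [h.deriv]; exact hC _ _
  have hlip := lipschitzOnWith_of_ae_hasDerivAt hab hc hd' hdC
  have hφl : LipschitzOnWith (Real.toNNReal B) φ (Metric.ball p₀ r) :=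
    Convex.lipschitzOnWith_of_nnnorm_fderiv_le (fun q hq => (hφ q hq).1)
      (fun q hq => by
        rw [← NNReal.coe_le_coe, coe_nnnorm, Real.coe_toNNReal B hB]; exact (hφ q hq).2.2)
      (convex_ball p₀ r)
  have hac : AbsolutelyContinuousOnInterval (fun t => φ (π (c t))) a b := by
    have h1 : LipschitzOnWith (Real.toNNReal B * (‖π‖₊ * Real.toNNReal C))
        (φ ∘ (π ∘ c)) (Icc a b) :=
      hφl.comp (π.lipschitz.comp_lipschitzOnWith hlip) hcb
    rw [← uIcc_of_le hab] at h1
    exact h1.absolutelyContinuousOnInterval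
  have key := eqOn_zero_of_ae_norm_deriv_le (f := fun t => c t - φ (π (c t)))
    (f' := fun t => deriv c t - fderiv ℝ φ (π (c t)) (π (deriv c t))) hab hlt (by positivity)
    (hc.sub hac) ?_ ?_ (by simp [hca])
  · intro t ht
    exact (sub_eq_zero.1 (key t ht)).symm
  · filter_upwards [hd', ae_restrict_mem measurableSet_Icc] with t h ht
    exact h.sub ((hφ _ (hcb t ht)).1.hasFDerivAt.comp_hasDerivAt t
      (π.hasFDerivAt.comp_hasDerivAt t h))
  · filter_upwards [hd, ae_restrict_mem measurableSet_Icc] with t ⟨y, h, ξ, hξ⟩ ht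
    rw [h.deriv]
    obtain ⟨-, h2, h3⟩ := hφ _ (hcb t ht)
    set T := fderiv ℝ φ (π (c t))
    set X := g (φ (π (c t))) y
    -- Tangency says that `T ∘ π` fixes the field on the graph. So the derivative of the defect `c -
    -- φ (π c)` is `1 - T ∘ π` applied to `g (c t) y - X`, which is bounded linearly by the defect.
    have h4 : T (π X) = X := by rw [← hξ, h2]
    have h5 : ‖g (c t) y - X‖ ≤ L * ‖c t - φ (π (c t))‖ := hg.norm_sub_le _ _ _
    have h6 : g (c t) y - T (π (g (c t) y)) = (g (c t) y - X) - T (π (g (c t) y - X)) := by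
      rw [map_sub, map_sub, h4]; abel
    rw [h6]
    calc _ ≤ ‖g (c t) y - X‖ + B * (‖π‖ * ‖g (c t) y - X‖) := by
          refine (norm_sub_le _ _).trans (add_le_add le_rfl ((T.le_opNorm _).trans ?_))
          exact mul_le_mul h3 (π.le_opNorm _) (norm_nonneg _) hB
      _ = (1 + B * ‖π‖) * ‖g (c t) y - X‖ := by ring
      _ ≤ (1 + B * ‖π‖) * (L * ‖c t - φ (π (c t))‖) := by gcongr
      _ = _ := by ring

/-- The set of points on immersed discs of maximal dimension is locally stable under
trajectories. -/
theorem IsTrajectory.eventually_mem_discPoints (hF : SmoothOn F V)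
    (h𝒰 : IsAdmissibleClass U V 𝒰) (hA : ∀ x, ∀ y ∈ A, y ∈ attainableSet F 𝒰 x → x ∈ A)
    (hmax : discPoints E A (k + 1) = ∅) {T : ℝ} {u : ℝ → EuclideanSpace ℝ (Fin m)} {γ : ℝ → M}
    (hu : u ∈ 𝒰 T) (h : IsTrajectory F T u γ) {t₀ : ℝ} (ht₀ : t₀ ∈ Ico 0 T)
    (hγ : γ t₀ ∈ discPoints E A k) : ∃ b > t₀, ∀ t ∈ Icc t₀ b, γ t ∈ discPoints E A k := by
  obtain ⟨Φ, hΦ, hi, h0, hΦA⟩ := exists_disc_of_mem_discPoints hγ (mem_chart_source E (γ t₀))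
  set x₀ := γ t₀
  have hx₀ : chartAt E x₀ x₀ ∈ (chartAt E x₀).target := mem_chart_target E x₀
  obtain ⟨K, hK, hKV, huK⟩ := h𝒰.exists_compact hu
  obtain ⟨ρ, hρ, hρO, g, g', L, C, hL, -, hg, hC, hgf⟩ :=
    exists_isLipschitzFamily (chartAt E x₀).open_target (contDiffOn_chartField hF x₀) hK hKV hx₀
  obtain ⟨π, φ, B, r, hB, hr, hφ0, hφ⟩ := exists_graph_ball hΦ hi
    (S := fun w => w ∈ Metric.ball (chartAt E x₀ x₀) ρ) (Q := fun w => (chartAt E x₀).symm w ∈ A)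
    (by rw [h0]; exact Metric.ball_mem_nhds _ hρ) hΦA
  rw [h0] at hφ0 hφ
  have hγc : ContinuousWithinAt γ (Icc 0 T) t₀ := h.1.1 t₀ ⟨ht₀.1, ht₀.2.le⟩
  have hev : ∀ᶠ t in 𝓝[Icc 0 T] t₀, γ t ∈ (chartAt E x₀).source ∧
      chartAt E x₀ (γ t) ∈ Metric.ball (chartAt E x₀ x₀) ρ ∧
      π (chartAt E x₀ (γ t)) ∈ Metric.ball (π (chartAt E x₀ x₀)) r := by
    have h1 : Tendsto (fun t => chartAt E x₀ (γ t)) (𝓝[Icc 0 T] t₀) (𝓝 (chartAt E x₀ x₀)) :=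
      ((chartAt E x₀).continuousAt (mem_chart_source E x₀)).tendsto.comp hγc
    exact (hγc.eventually ((chartAt E x₀).open_source.mem_nhds (mem_chart_source E x₀))).and
      ((h1.eventually (Metric.ball_mem_nhds _ hρ)).and
        (((π.continuous.tendsto _).comp h1).eventually (Metric.ball_mem_nhds _ hr)))
  obtain ⟨δ, hδ, hball⟩ := Metric.mem_nhdsWithin_iff.1 hev
  set D := (1 + B * ‖π‖) * L with hD
  have hD0 : 0 ≤ D := by positivity
  -- The three bounds keep the curve in the chart region and the time in `[0, T]`, and give the
  -- smallness `D ε ≤ 1/2` used in the Gronwall estimate.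
  set ε := min (min (δ / 2) (T - t₀)) (1 / (2 * (D + 1)))
  have hε : 0 < ε := lt_min (lt_min (half_pos hδ) (sub_pos.2 ht₀.2)) (by positivity)
  have hε1 : ε ≤ δ / 2 := (min_le_left _ _).trans (min_le_left _ _)
  have hε2 : ε ≤ T - t₀ := (min_le_left _ _).trans (min_le_right _ _)
  have hε3 : D * ε ≤ 1 / 2 := by
    calc D * ε ≤ D * (1 / (2 * (D + 1))) := by gcongr; exact min_le_right _ _
      _ ≤ 1 / 2 := by
        rw [mul_one_div, div_le_div_iff₀ (by positivity) (by norm_num)]; linarith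
  have hab : t₀ ≤ t₀ + ε := by linarith
  have hbT : t₀ + ε ≤ T := by linarith
  have hall : ∀ t ∈ Icc t₀ (t₀ + ε), γ t ∈ (chartAt E x₀).source ∧
      chartAt E x₀ (γ t) ∈ Metric.ball (chartAt E x₀ x₀) ρ ∧
      π (chartAt E x₀ (γ t)) ∈ Metric.ball (π (chartAt E x₀ x₀)) r := fun t ht =>
    hball ⟨by rw [Metric.mem_ball, Real.dist_eq, abs_of_nonneg (by linarith [ht.1])]
              linarith [ht.2], by linarith [ht.1, ht₀.1], by linarith [ht.2]⟩
  obtain ⟨hac, hd⟩ := h.chart_curve x₀ ht₀.1 hab hbT fun t ht => (hall t ht).1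
  have hφi : ∀ q ∈ Metric.ball (π (chartAt E x₀ x₀)) r, Function.Injective (fderiv ℝ φ q) :=
    fun q hq => Function.LeftInverse.injective (g := π) (hφ q hq).1.2.1
  have key := eqOn_graph_of_tangent hg hL hC hB
    (fun q hq => ⟨(hφ q hq).1.1.differentiableAt one_ne_zero, (hφ q hq).1.2⟩) hab
    (by rwa [add_sub_cancel_left]) hac (fun t ht => (hall t ht).2.2) hφ0 (by
      have hsub : Icc t₀ (t₀ + ε) ⊆ Icc 0 T := Icc_subset_Icc ht₀.1 hbT
      filter_upwards [hd, ae_restrict_of_ae_restrict_of_subset hsub huK,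
        ae_restrict_of_ae_restrict_of_subset hsub (h𝒰.ae_mem hu),
        ae_restrict_mem measurableSet_Icc] with t h1 h2 h3 ht
      obtain ⟨-, h4, h5⟩ := hall t ht
      obtain ⟨h6, h7, h8⟩ := hφ _ h5
      refine ⟨⟨u t, h2⟩, ?_, ?_⟩
      · rwa [hgf _ h4]
      · rw [hgf _ h7]
        exact chartField_mem_range hF h𝒰 hA hmax (by simp) h6.1 (hφi _ h5) (hρO h7) h8 h3)
  refine ⟨t₀ + ε, by linarith, fun t ht => ?_⟩
  obtain ⟨h3, -, h5⟩ := hall t ht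
  obtain ⟨h6, h7, h8⟩ := hφ _ h5
  have h9 := mem_discPoints_of_immersion (k := k) (by simp) h6.1 (hφi _ h5) (hρO h7) h8
  rwa [key t ht, (chartAt E x₀).left_inv h3] at h9

end ForwardInvariance

/-! ### The clopen argument. -/

section Controllability

variable {E : Type*} [NormedAddCommGroup E] [NormedSpace ℝ E] [FiniteDimensional ℝ E]
    {M : Type*} [TopologicalSpace M] [ChartedSpace E M] [IsManifold 𝓘(ℝ, E) ∞ M] {m : ℕ}
    {F : (x : M) → EuclideanSpace ℝ (Fin m) → TangentSpace 𝓘(ℝ, E) x}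
    {U V : Set (EuclideanSpace ℝ (Fin m))} {𝒰 : ℝ → Set (ℝ → EuclideanSpace ℝ (Fin m))}

/-- Local controllability is used twice: with backward invariance it gives closedness, and with
forward invariance along whole trajectories it gives openness. -/
theorem isClopen_discPoints (hF : SmoothOn F V) (h𝒰 : IsAdmissibleClass U V 𝒰)
    (h : LocallyControllable F 𝒰) {A : Set M} {k : ℕ}
    (hA : ∀ x, ∀ y ∈ A, y ∈ attainableSet F 𝒰 x → x ∈ A) (hmax : discPoints E A (k + 1) = ∅) :
    IsClopen (discPoints E A k) := by
  have hclosed : IsClosed (discPoints E A k) := by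
    refine isClosed_of_closure_subset fun z hz => ?_
    obtain ⟨d, hd, hdA⟩ := mem_closure_iff_nhds.1 hz _ (mem_interior_iff_mem_nhds.1 (h z))
    exact mem_discPoints_of_mem_attainableSet hF h𝒰 hA hdA hd
  refine ⟨hclosed, isOpen_iff_mem_nhds.2 fun z hz => ?_⟩
  refine mem_of_superset (mem_interior_iff_mem_nhds.1 (h z)) ?_
  rintro w ⟨T, hT, u, hu, γ, hγ, h0, rfl⟩
  -- Continuous induction on `[0, T]`: the set of good times is closed and can be extended to the
  -- right.
  refine IsClosed.Icc_subset_of_forall_exists_gt (s := γ ⁻¹' discPoints E A k) (a := 0) ?_ ?_ ?_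
    ⟨hT, le_rfl⟩
  · rw [inter_comm]
    exact hγ.1.1.preimage_isClosed_of_isClosed isClosed_Icc hclosed
  · rwa [mem_preimage, h0]
  · rintro t ⟨ht, htT⟩ s hs
    obtain ⟨b, hb, hmem⟩ := hγ.eventually_mem_discPoints hF h𝒰 hA hmax hu htT ht
    have h1 : t < min b s := lt_min hb hs
    exact ⟨min b s, hmem _ ⟨h1.le, min_le_left _ _⟩, h1, min_le_right _ _⟩

/-- Local controllability implies controllability. -/
theorem IsAdmissibleClass.controllable [ConnectedSpace M] (hF : SmoothOn F V)
    (h𝒰 : IsAdmissibleClass U V 𝒰) (h : LocallyControllable F 𝒰) : Controllable F 𝒰 := by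
  refine fun x => eq_univ_of_forall fun y => ?_
  let A : Set M := {z | y ∈ attainableSet F 𝒰 z}
  have hA : ∀ x, ∀ z ∈ A, z ∈ attainableSet F 𝒰 x → x ∈ A := fun x z hz hxz =>
    h𝒰.attainableSet_trans hxz hz
  have hyA : y ∈ A := interior_subset (s := attainableSet F 𝒰 y) (h y)
  have hy : y ∈ discPoints E A 0 :=
    ⟨y, mem_chart_source E y, fun _ => chartAt E y y, contDiffAt_const,
      Function.injective_of_subsingleton _, rfl, Eventually.of_forall fun _ => by
        rwa [(chartAt E y).left_inv (mem_chart_source E y)]⟩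
  classical
  -- Injectivity of the differential bounds the dimension of a disc by that of `E`, so a maximum up
  -- to this bound is a true maximum.
  set k := Nat.findGreatest (fun k => (discPoints E A k).Nonempty) (Module.finrank ℝ E) with hk
  have hne : (discPoints E A k).Nonempty :=
    Nat.findGreatest_spec (P := fun k => (discPoints E A k).Nonempty) (Nat.zero_le _) ⟨y, hy⟩
  have hmax : discPoints E A (k + 1) = ∅ := by
    by_contra hne'
    have h1 := nonempty_iff_ne_empty.2 hne'
    have h2 := Nat.le_findGreatest (P := fun k => (discPoints E A k).Nonempty)
      (le_finrank_of_discPoints_nonempty h1) h1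
    omega
  have hx : x ∈ discPoints E A k := by
    rw [(isClopen_discPoints hF h𝒰 h hA hmax).eq_univ hne]
    exact mem_univ x
  exact discPoints_subset A k hx

end Controllability

/-! ### The three classes of controls are admissible. -/

section Classes

variable {m : ℕ} {U V : Set (EuclideanSpace ℝ (Fin m))}

theorem measurePreserving_add_right_restrict_Icc (a b s : ℝ) :
    MeasurePreserving (fun t => t + s) (volume.restrict (Icc a b))
      (volume.restrict (Icc (a + s) (b + s))) := by
  have := (measurePreserving_add_right volume s).restrict_preimage
    (measurableSet_Icc (a := a + s) (b := b + s))
  simpa using this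

theorem Icc_add_eq_union {T₁ T₂ : ℝ} (h₁ : 0 ≤ T₁) (h₂ : 0 ≤ T₂) :
    Icc 0 (T₁ + T₂) = Icc 0 T₁ ∪ Ioc T₁ (T₁ + T₂) :=
  (Icc_union_Ioc_eq_Icc h₁ (by linarith)).symm

theorem measurePreserving_sub_right_restrict_Icc (T₁ T₂ : ℝ) :
    MeasurePreserving (fun t => t - T₁) (volume.restrict (Icc T₁ (T₁ + T₂)))
      (volume.restrict (Icc 0 T₂)) := by
  have := measurePreserving_add_right_restrict_Icc T₁ (T₁ + T₂) (-T₁)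
  simpa [sub_eq_add_neg] using this

theorem ae_restrict_concat {X : Type*} {p : X → Prop} {T₁ T₂ : ℝ} (h₁ : 0 ≤ T₁) (h₂ : 0 ≤ T₂)
    {u₁ u₂ : ℝ → X} (hu₁ : ∀ᵐ t ∂(volume.restrict (Icc 0 T₁)), p (u₁ t))
    (hu₂ : ∀ᵐ t ∂(volume.restrict (Icc 0 T₂)), p (u₂ t)) :
    ∀ᵐ t ∂(volume.restrict (Icc 0 (T₁ + T₂))), p (if t ≤ T₁ then u₁ t else u₂ (t - T₁)) := by
  rw [Icc_add_eq_union h₁ h₂, ae_restrict_union_iff]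
  constructor
  · filter_upwards [hu₁, ae_restrict_mem measurableSet_Icc] with t h ht
    rwa [if_pos ht.2]
  · filter_upwards [ae_restrict_of_ae_restrict_of_subset Ioc_subset_Icc_self
      ((measurePreserving_sub_right_restrict_Icc T₁ T₂).quasiMeasurePreserving.ae hu₂),
      ae_restrict_mem measurableSet_Ioc] with t h ht
    rwa [if_neg (not_le.2 ht.1)]

theorem aestronglyMeasurable_concat {X : Type*} [TopologicalSpace X]
    {T₁ T₂ : ℝ} (h₁ : 0 ≤ T₁) (h₂ : 0 ≤ T₂) {u₁ u₂ : ℝ → X}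
    (hu₁ : AEStronglyMeasurable u₁ (volume.restrict (Icc 0 T₁)))
    (hu₂ : AEStronglyMeasurable u₂ (volume.restrict (Icc 0 T₂))) :
    AEStronglyMeasurable (fun t => if t ≤ T₁ then u₁ t else u₂ (t - T₁))
      (volume.restrict (Icc 0 (T₁ + T₂))) := by
  refine ⟨fun t => if t ≤ T₁ then hu₁.mk u₁ t else hu₂.mk u₂ (t - T₁), ?_, ?_⟩
  · exact StronglyMeasurable.ite measurableSet_Iic hu₁.stronglyMeasurable_mk
      (hu₂.stronglyMeasurable_mk.comp_measurable (measurable_id.sub_const T₁))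
  · have := ae_restrict_concat (p := fun q : X × X => q.1 = q.2) (u₁ := fun t => (u₁ t, hu₁.mk u₁ t))
      (u₂ := fun t => (u₂ t, hu₂.mk u₂ t)) h₁ h₂ hu₁.ae_eq_mk hu₂.ae_eq_mk
    filter_upwards [this] with t ht
    split_ifs at ht ⊢ <;> exact ht

/-- The measurable controls essentially valued in a member of a directed family of relatively
compact sets. -/
theorem isAdmissibleClass_of_mem_iff {𝒰 : ℝ → Set (ℝ → EuclideanSpace ℝ (Fin m))}
    {𝒮 : Set (Set (EuclideanSpace ℝ (Fin m)))} (hUV : U ⊆ V) (h𝒮U : ∀ S ∈ 𝒮, S ⊆ U)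
    (hsup : ∀ S₁ ∈ 𝒮, ∀ S₂ ∈ 𝒮, ∃ S ∈ 𝒮, S₁ ∪ S₂ ⊆ S) (hcov : ∀ v ∈ U, ∃ S ∈ 𝒮, v ∈ S)
    (hK : ∀ S ∈ 𝒮, ∃ K, IsCompact K ∧ K ⊆ V ∧ S ⊆ K)
    (h : ∀ T u, u ∈ 𝒰 T ↔ AEStronglyMeasurable u (volume.restrict (Icc 0 T)) ∧
      ∃ S ∈ 𝒮, ∀ᵐ t ∂(volume.restrict (Icc 0 T)), u t ∈ S) : IsAdmissibleClass U V 𝒰 where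
  subset := hUV
  restrict {T u} hu {s t} hs hst htT := by
    obtain ⟨h1, S, hS, h2⟩ := (h T u).1 hu
    have hmp := measurePreserving_add_right_restrict_Icc 0 (t - s) s
    rw [zero_add, sub_add_cancel] at hmp
    have hsub : Icc s t ⊆ Icc 0 T := Icc_subset_Icc hs htT
    exact (h _ _).2 ⟨(h1.mono_set hsub).comp_quasiMeasurePreserving hmp.quasiMeasurePreserving, S,
      hS, hmp.quasiMeasurePreserving.ae (ae_restrict_of_ae_restrict_of_subset hsub h2)⟩
  concat {T₁ T₂ u₁ u₂} hT₁ hT₂ hu₁ hu₂ := by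
    obtain ⟨h1, S₁, hS₁, h1'⟩ := (h _ _).1 hu₁
    obtain ⟨h2, S₂, hS₂, h2'⟩ := (h _ _).1 hu₂
    obtain ⟨S, hS, hsub⟩ := hsup S₁ hS₁ S₂ hS₂
    exact (h _ _).2 ⟨aestronglyMeasurable_concat hT₁ hT₂ h1 h2, S, hS, ae_restrict_concat
      (p := fun v => v ∈ S) hT₁ hT₂ (h1'.mono fun t ht => hsub (Or.inl ht))
      (h2'.mono fun t ht => hsub (Or.inr ht))⟩
  const {v} hv {T} _ := by
    obtain ⟨S, hS, hvS⟩ := hcov v hv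
    exact (h _ _).2 ⟨aestronglyMeasurable_const, S, hS, Eventually.of_forall fun _ => hvS⟩
  aestronglyMeasurable hu := ((h _ _).1 hu).1
  ae_mem hu := by
    obtain ⟨-, S, hS, h1⟩ := (h _ _).1 hu
    exact h1.mono fun t ht => h𝒮U S hS ht
  exists_compact hu := by
    obtain ⟨-, S, hS, h1⟩ := (h _ _).1 hu
    obtain ⟨K, hK, hKV, hSK⟩ := hK S hS
    exact ⟨K, hK, hKV, h1.mono fun t ht => hSK ht⟩

theorem isAdmissibleClass_compactlyBoundedControls :
    IsAdmissibleClass U U (compactlyBoundedControls U) :=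
  isAdmissibleClass_of_mem_iff (𝒮 := {K | IsCompact K ∧ K ⊆ U}) subset_rfl (fun _ hS => hS.2)
    (fun _ h₁ _ h₂ => ⟨_, ⟨h₁.1.union h₂.1, union_subset h₁.2 h₂.2⟩, subset_rfl⟩)
    (fun v hv => ⟨{v}, ⟨isCompact_singleton, singleton_subset_iff.2 hv⟩, rfl⟩)
    (fun S hS => ⟨S, hS.1, hS.2, subset_rfl⟩)
    (fun T u => by simp only [compactlyBoundedControls, mem_ofPred_eq, and_assoc])

theorem memLp_top_iff {X G : Type*} [MeasurableSpace X] [NormedAddCommGroup G] {μ : Measure X}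
    {f : X → G} : MemLp f ∞ μ ↔ AEStronglyMeasurable f μ ∧ ∃ C : ℝ, ∀ᵐ x ∂μ, ‖f x‖ ≤ C := by
  refine ⟨fun h => ⟨h.1, (eLpNorm f ∞ μ).toReal, ?_⟩, fun ⟨h, C, hC⟩ => memLp_top_of_bound h C hC⟩
  filter_upwards [ae_le_eLpNormEssSup (f := f) (μ := μ)] with x hx
  rw [← eLpNorm_exponent_top] at hx
  simpa using ENNReal.toReal_mono h.2.ne hx

/-- A bounded part of `U` is relatively compact only in `closure U`, which is why smoothness is
needed there. -/
theorem isAdmissibleClass_boundedControls : IsAdmissibleClass U (closure U) (boundedControls U) :=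
  isAdmissibleClass_of_mem_iff (𝒮 := range fun C : ℝ => U ∩ Metric.closedBall 0 C) subset_closure
    (by rintro _ ⟨C, rfl⟩; exact inter_subset_left)
    (by
      rintro _ ⟨C₁, rfl⟩ _ ⟨C₂, rfl⟩
      refine ⟨_, ⟨max C₁ C₂, rfl⟩, ?_⟩
      exact union_subset
        (inter_subset_inter_right _ (Metric.closedBall_subset_closedBall (le_max_left _ _)))
        (inter_subset_inter_right _ (Metric.closedBall_subset_closedBall (le_max_right _ _))))
    (fun v hv => ⟨_, ⟨‖v‖, rfl⟩, hv, by simp⟩)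
    (by
      rintro _ ⟨C, rfl⟩
      exact ⟨closure U ∩ Metric.closedBall 0 C, (isCompact_closedBall 0 C).inter_left isClosed_closure,
        inter_subset_left, inter_subset_inter_left _ subset_closure⟩)
    (fun T u => by
      simp only [boundedControls, mem_ofPred_eq, memLp_top_iff, exists_range_iff, mem_inter_iff,
        mem_closedBall_zero_iff, and_assoc]
      refine and_congr_right fun _ => ⟨fun ⟨⟨C, h1⟩, h2⟩ => ⟨C, h2.and h1⟩, fun ⟨C, h1⟩ =>
        ⟨⟨C, h1.mono fun _ h => h.2⟩, h1.mono fun _ h => h.1⟩⟩)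

theorem exists_eq_or_exists_mem_Ioo {τ : ℕ → ℝ} {t : ℝ} (h0 : τ 0 ≤ t) :
    ∀ {n : ℕ}, t ≤ τ n → (∃ i, t = τ i) ∨ ∃ i < n, t ∈ Ioo (τ i) (τ (i + 1))
  | 0, h => Or.inl ⟨0, le_antisymm h h0⟩
  | n + 1, h => by
    rcases le_or_gt t (τ n) with h1 | h1
    · rcases exists_eq_or_exists_mem_Ioo h0 h1 with h2 | ⟨i, hi, h2⟩
      · exact Or.inl h2
      · exact Or.inr ⟨i, by omega, h2⟩
    · rcases h.eq_or_lt with h2 | h2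
      · exact Or.inl ⟨_, h2⟩
      · exact Or.inr ⟨n, by omega, h1, h2⟩

theorem ae_exists_mem_Ioo (τ : ℕ → ℝ) (n : ℕ) :
    ∀ᵐ t ∂(volume.restrict (Icc (τ 0) (τ n))), ∃ i < n, t ∈ Ioo (τ i) (τ (i + 1)) := by
  rw [ae_restrict_iff' measurableSet_Icc]
  have : ∀ᵐ t : ℝ, ∀ i, t ≠ τ i := ae_all_iff.2 fun i => by simp [ae_iff]
  filter_upwards [this] with t h1 h2
  exact (exists_eq_or_exists_mem_Ioo h2.1 h2.2).resolve_left fun ⟨i, hi⟩ => h1 i hi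

theorem isAdmissibleClass_piecewiseConstantControls :
    IsAdmissibleClass U U (piecewiseConstantControls U) where
  subset := subset_rfl
  restrict {T u} hu {s t} hs hst htT := by
    obtain ⟨hU, n, τ, hτ, h0, hn, hc⟩ := hu
    -- The partition is clamped to `[s, t]` and translated; intervals that become degenerate impose
    -- no condition.
    refine ⟨fun r hr => hU _ ⟨by linarith [hr.1], by linarith [hr.2]⟩, n,
      fun i => max s (min t (τ i)) - s, fun i j hij => ?_, ?_, ?_, fun i hi => ?_⟩
    · exact sub_le_sub_right (max_le_max_left _ (min_le_min_left _ (hτ hij))) _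
    · simp [h0, (min_le_right t 0).trans hs]
    · simp [hn, htT, hst]
    · obtain ⟨v, hv⟩ := hc i hi
      refine ⟨v, fun r hr => hv _ ?_⟩
      have h1 : max s (min t (τ i)) < r + s := by linarith [hr.1]
      have h2 : r + s < max s (min t (τ (i + 1))) := by linarith [hr.2]
      have h3 := (lt_max_iff.1 h2).resolve_left (not_lt.2 ((le_max_left _ _).trans h1.le))
      obtain ⟨h4, h5⟩ := lt_min_iff.1 h3
      exact ⟨(min_lt_iff.1 ((le_max_right _ _).trans_lt h1)).resolve_left (not_lt.2 h4.le), h5⟩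
  concat {T₁ T₂ u₁ u₂} hT₁ hT₂ hu₁ hu₂ := by
    obtain ⟨hU₁, n₁, τ₁, hτ₁, h0₁, hn₁, hc₁⟩ := hu₁
    obtain ⟨hU₂, n₂, τ₂, hτ₂, h0₂, hn₂, hc₂⟩ := hu₂
    -- With truncated subtraction the second term is `τ₂ 0 = 0` up to index `n₁`, after which the
    -- first is constantly `T₁`.
    refine ⟨fun t ht => ?_, n₁ + n₂, fun i => τ₁ (min i n₁) + τ₂ (i - n₁), fun i j hij => ?_, ?_, ?_,
      fun i hi => ?_⟩
    · dsimp only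
      split_ifs with h
      · exact hU₁ t ⟨ht.1, h⟩
      · exact hU₂ _ ⟨by linarith [not_le.1 h], by linarith [ht.2]⟩
    · exact add_le_add (hτ₁ (min_le_min_right _ hij)) (hτ₂ (Nat.sub_le_sub_right hij _))
    · simp [h0₁, h0₂]
    · simp [hn₁, hn₂]
    · rcases lt_or_ge i n₁ with h | h
      · obtain ⟨v, hv⟩ := hc₁ i h
        refine ⟨v, fun t ht => ?_⟩
        have h1 : i + 1 - n₁ = 0 := by omega
        simp only [min_eq_left h.le, min_eq_left (Nat.succ_le_of_lt h), Nat.sub_eq_zero_of_le h.le,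
          h1, h0₂, add_zero] at ht
        have h2 : τ₁ (i + 1) ≤ T₁ := hn₁ ▸ hτ₁ h
        dsimp only
        rw [if_pos (ht.2.le.trans h2)]
        exact hv t ht
      · obtain ⟨v, hv⟩ := hc₂ (i - n₁) (by omega)
        refine ⟨v, fun t ht => ?_⟩
        have h1 : i + 1 - n₁ = i - n₁ + 1 := by omega
        simp only [min_eq_right h, min_eq_right (h.trans i.le_succ), h1, hn₁] at ht
        have h2 : 0 ≤ τ₂ (i - n₁) := h0₂ ▸ hτ₂ (Nat.zero_le _)
        dsimp only
        rw [if_neg (not_le.2 (by linarith [ht.1]))]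
        exact hv _ ⟨by linarith [ht.1], by linarith [ht.2]⟩
  const {v} hv {T} hT :=
    ⟨fun _ _ => hv, 1, fun i => if i = 0 then 0 else T, fun i j hij => by
      dsimp only
      split_ifs with h1 h2 h2
      · exact le_rfl
      · exact hT
      · omega
      · exact le_rfl, rfl, rfl, fun _ _ => ⟨v, fun _ _ => rfl⟩⟩
  aestronglyMeasurable {T u} hu := by
    obtain ⟨-, n, τ, -, h0, hn, hc⟩ := hu
    have h1 : AEStronglyMeasurable u
        (volume.restrict ((⋃ i : Fin n, Ioo (τ i) (τ (i + 1))) ∪ ⋃ i : ℕ, {τ i})) := by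
      refine aestronglyMeasurable_union_iff.2 ⟨aestronglyMeasurable_iUnion_iff.2 fun i => ?_,
        aestronglyMeasurable_iUnion_iff.2 fun i => ?_⟩
      · obtain ⟨v, hv⟩ := hc i i.2
        refine (aestronglyMeasurable_const (b := v)).congr ?_
        filter_upwards [ae_restrict_mem measurableSet_Ioo] with t ht using (hv t ht).symm
      · rw [Measure.restrict_singleton]; simp
    refine h1.mono_set fun t ht => ?_
    rw [← h0, ← hn] at ht
    rcases exists_eq_or_exists_mem_Ioo ht.1 ht.2 with ⟨i, hi⟩ | ⟨i, hi, h⟩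
    · exact Or.inr (mem_iUnion.2 ⟨i, hi⟩)
    · exact Or.inl (mem_iUnion.2 ⟨⟨i, hi⟩, h⟩)
  ae_mem {T u} hu := by
    filter_upwards [ae_restrict_mem measurableSet_Icc] with t ht using hu.1 t ht
  exists_compact {T u} hu := by
    obtain ⟨hU, n, τ, -, h0, hn, hc⟩ := hu
    choose! v hv using hc
    -- Intersecting with `U` discards the arbitrary values attached to empty intervals.
    refine ⟨U ∩ v '' Iio n, (((finite_Iio n).image v).inter_of_right U).isCompact,
      inter_subset_left, ?_⟩
    have h1 := ae_exists_mem_Ioo τ n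
    rw [h0, hn] at h1
    filter_upwards [ae_restrict_mem measurableSet_Icc, h1] with t ht ⟨i, hi, h⟩
    exact ⟨hU t ht, i, hi, (hv i hi t h).symm⟩

end Classes

end ControlSystem

theorem theorem1 {E : Type*} [NormedAddCommGroup E] [NormedSpace ℝ E] [FiniteDimensional ℝ E]
    {M : Type*} [TopologicalSpace M] [ChartedSpace E M] [IsManifold 𝓘(ℝ, E) ∞ M]
    [T2Space M] [ConnectedSpace M] {m : ℕ}
    (F : (x : M) → EuclideanSpace ℝ (Fin m) → TangentSpace 𝓘(ℝ, E) x)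
    (U : Set (EuclideanSpace ℝ (Fin m))) (hF : ControlSystem.SmoothOn F U) :
    (ControlSystem.LocallyControllable F (ControlSystem.piecewiseConstantControls U) →
      ControlSystem.Controllable F (ControlSystem.piecewiseConstantControls U)) ∧
    (ControlSystem.SmoothOn F (closure U) →
      ControlSystem.LocallyControllable F (ControlSystem.boundedControls U) →
      ControlSystem.Controllable F (ControlSystem.boundedControls U)) ∧
    (ControlSystem.LocallyControllable F (ControlSystem.compactlyBoundedControls U) →
      ControlSystem.Controllable F (ControlSystem.compactlyBoundedControls U)) := by
  exact ⟨ControlSystem.isAdmissibleClass_piecewiseConstantControls.controllable hF,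
    fun hF' => ControlSystem.isAdmissibleClass_boundedControls.controllable hF',
    ControlSystem.isAdmissibleClass_compactlyBoundedControls.controllable hF⟩
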